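/- **Setting.** Let $\mathcal G=(V,E)$ be a finite graph without loops, regarded as a directed graph with $(i,j)\in E\Rightarrow (j,i)\in E$, and let $m=|E|$ be the number of directed edges. Let $d\ge 2$, let $\mathcal X\subset\mathbb R^d$ be a finite arm set, $\mathbf M_\star\in\mathbb R^{d\times d}$ an unknown matrix, $z_{xx'}=\mathrm{vec}(xx'^{\top})\in\mathbb R^{d^2}$ the edge-arms and $\theta_\star=\mathrm{vec}(\mathbf M_\star)$, so that $\langle z_{xx'},\theta_\star\rangle=x^\top\mathbf M_\star x'$. Assume $\|z_{xx'}\|_2\le L$ and $x^\top\mathbf M_\star x'\ge 0$ for all $x,x'\in\mathcal X$, and $\|\mathbf M_\star\|_F\le S$ (hence $0\le x^\top \mathbf M_\star x'\le LS$). In each round $t$ a joint arm $(x_t^{(i)})_{i\in V}\in\mathcal X^V$ is played and the rewards $y_t^{(i,j)}=x_t^{(i)\top}\mathbf M_\star x_t^{(j)}+\eta_t^{(i,j)}$, $(i,j)\in E$, are observed; put $z_t^{(i,j)}=z_{x_t^{(i)}x_t^{(j)}}$. With respect to a filtration $(\mathcal F_t)_{t\ge 0}$, the noise $\eta_t=(\eta_t^{(i,j)})_{(i,j)\in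 E}$ is $\mathcal F_t$-measurable and, given $\mathcal F_{t-1}$, centred and $\sigma$-sub-Gaussian ($\sigma\ge0$) in the sense that $\mathbb E[\exp(\sum_{e\in E} c_e\eta_t^{e})\mid\mathcal F_{t-1}]\le\exp(\frac{\sigma^2}{2}\sum_{e\in E} c_e^2)$ a.s. for all $c\in\mathbb R^E$, the left-hand exponential being integrable (for example, all $\eta_t^{(i,j)}$ are independent, centred and $\sigma$-sub-Gaussian). Let $(x_\star^{(i)})_{i\in V}\in\mathcal X^V$ maximize $\sum_{(i,j)\in E}x^{(i)\top}\mathbf M_\star x^{(j)}$, and let $\mathrm{OPT}$ be the maximum; assume $\mathrm{OPT}>0$. Let $$R_\alpha(T)=\sum_{t=1}^T\Big[\alpha\,\mathrm{OPT}-\sum_{(i,j)\in E}x_t^{(i)\top}\mathbf M_\star x_t^{(j)}\Big].$$ **Algorithm.** Let $(V_1,V_2)$ be a partition of $V$ (a cut). Let $m_{1\to2},m_{2\to1},m_1,m_2$ be the numbers of edges in $E$ from $V_1$ to $V_2$, from $V_2$ to $V_1$, inside $V_1$, and inside $V_2$, and put $$Z(x,x')=m_{1\to2}z_{xx'}+m_{2\to1}z_{x'x}+m_1z_{xx}+m_2z_{x'x'}.$$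 For $\lambda>0$ and $\delta\in(0,1]$ let $\mathbf A_t=\lambda I+\sum_{s\le t}\sum_{e\in E}z_s^{e}z_s^{e\top}$, $\hat\theta_t=\mathbf A_t^{-1}\sum_{s\le t}\sum_{e\in E}y_s^{e}z_s^{e}$ and $$C_t=\Big\{\theta:\|\theta-\hat\theta_t\|_{\mathbf A_t}\le\sigma\sqrt{d^2\log\tfrac{1+tmL^2/\lambda}{\delta}}+\sqrt\lambda S\Big\},\qquad \|v\|_{\mathbf A}=\sqrt{v^\top\mathbf Av}.$$ In rounds $t=1,\dots,T$ the algorithm chooses, as a function of the past (i.e. $\mathcal F_{t-1}$-measurably), $(x_t,x_t',\tilde\theta_{t-1})\in\operatorname{argmax}_{(x,x',\theta)\in\mathcal X^2\times C_{t-1}}\langle Z(x,x'),\theta\rangle$, ties being broken arbitrarily. All nodes of $V_1$ play $x_t$ and all nodes of $V_2$ play $x_t'$. **Parameters.** Let $$\gamma=\min_{x\in\mathcal X}\frac{\langle z_{xx},\theta_\star\rangle}{\frac1m\mathrm{OPT}}.$$ Let $(x_\star,x_\star')\in\mathcal X^2$ maximize $\langle z_{xx'}+z_{x'x},\theta_\star\rangle$,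 let $(\tilde x_\star,\tilde x_\star')\in\mathcal X^2$ maximize $\langle Z(x,x'),\theta_\star\rangle$ (any maximizers), and let $$\Delta=\langle Z(\tilde x_\star,\tilde x'_\star)-Z(x_\star,x_\star'),\theta_\star\rangle,\qquad \epsilon=\frac{\Delta}{\mathrm{OPT}},\qquad \alpha=1-\Big[\frac{m_1+m_2}{m}(1-\gamma)-\epsilon\Big].$$ **Theorem 4.1.** One has $0\le\gamma\le1$, $\Delta\ge0$, $\epsilon\ge0$, $\alpha\le1$, and with probability at least $1-\delta$ $$R_\alpha(T)\le\sqrt{32\,Tm\,d^2\max(2,(LS)^2)\log\Big(1+\frac{TmL^2/\lambda}{d^2}\Big)}\left(\sigma\sqrt{d^2\log\frac{1+TmL^2/\lambda}{\delta}}+\sqrt\lambda S\right)+LSm\left\lceil d^2\log_2\Big(\frac{TmL^2/\lambda}{\delta}\Big)\right\rceil^+,$$ where $\lceil a\rceil^+=\max(\lceil a\rceil,0)$ (for $T=0$ the last term is $0$). Up to logarithmic factors, the first term is $(\sigma d^2+dS\sqrt\lambda)\sqrt{Tm\max(2,(LS)^2)}$. Moreover: * if the cut contains at least half of the edges, i.e.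 $m_{1\to2}+m_{2\to1}\ge m/2$, then $\epsilon\le\frac12$ and $\alpha\ge\frac12$; * this is the case if $(V_1,V_2)$ is the output of the greedy algorithm Approx-MAX-CUT, which runs through the nodes in any order and puts node $i$ into $V_2$ if $i$ has strictly more neighbours in the current $V_1$ than in the current $V_2$, and into $V_1$ otherwise; * if the graph is bipartite with parts $V_1,V_2$ (every edge joins $V_1$ and $V_2$), then $\epsilon=0$ and $\alpha=1$, so that the bound holds for the regret $R_1(T)$ itself. -/

import Mathlib

open MeasureTheory Matrix

namespace GraphicalBilinear

noncomputable section

/-! ### The graph and its cuts -/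

/-- The directed edge set `E` of the graph: all ordered pairs of neighbours, so that `(i, j) ∈ E`
implies `(j, i) ∈ E`. Its cardinality is `m`. -/
def edges {V : Type*} [Fintype V] (G : SimpleGraph V) [DecidableRel G.Adj] : Finset (V × V) :=
  Finset.univ.filter fun e => G.Adj e.1 e.2

/-- The number of directed edges that go from `U` to `W`. For a cut `(V₁, V₂)` this gives
`m_{1→2}`, `m_{2→1}`, `m₁ = edgesFromTo G V₁ V₁` and `m₂ = edgesFromTo G V₂ V₂`. -/
def edgesFromTo {V : Type*} [Fintype V] [DecidableEq V] (G : SimpleGraph V) [DecidableRel G.Adj]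
    (U W : Finset V) : ℕ :=
  ((edges G).filter fun e => e.1 ∈ U ∧ e.2 ∈ W).card

/-- One step of the greedy cut: node `i` joins `V₂` if it has strictly more neighbours in `V₁`
than in `V₂`, and joins `V₁` otherwise. -/
def approxMaxCutStep {V : Type*} [DecidableEq V] (G : SimpleGraph V) [DecidableRel G.Adj]
    (c : Finset V × Finset V) (i : V) : Finset V × Finset V :=
  if (c.2.filter fun j => G.Adj i j).card < (c.1.filter fun j => G.Adj i j).card
  then (c.1, insert i c.2) else (insert i c.1, c.2)

/-- The greedy algorithm Approx-MAX-CUT, processing the nodes in the order of the list `l`. -/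
def approxMaxCut {V : Type*} [DecidableEq V] (G : SimpleGraph V) [DecidableRel G.Adj]
    (l : List V) : Finset V × Finset V :=
  l.foldl (approxMaxCutStep G) (∅, ∅)

/-! ### Arms and rewards -/

/-- The edge-arm `z_{x x'} = vec(x x'ᵀ)` (columns concatenated), a vector with `d²` coordinates. -/
def edgeArm {d : ℕ} (x x' : Fin d → ℝ) : Fin d × Fin d → ℝ :=
  vec (vecMulVec x x')

/-- The expected bilinear reward `xᵀ M x'` of an edge. -/
def edgeReward {d : ℕ} (M : Matrix (Fin d) (Fin d) ℝ) (x x' : Fin d → ℝ) : ℝ :=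
  x ⬝ᵥ (M *ᵥ x')

/-- The linear form of the reward: `xᵀ M x' = ⟨z_{x x'}, vec M⟩`. -/
theorem edgeArm_dotProduct_vec {d : ℕ} (M : Matrix (Fin d) (Fin d) ℝ) (x x' : Fin d → ℝ) :
    edgeArm x x' ⬝ᵥ vec M = edgeReward M x x' := by
  simp only [edgeArm, edgeReward, dotProduct, mulVec, vec, vecMulVec_apply, Fintype.sum_prod_type,
    Finset.mul_sum]
  rw [Finset.sum_comm]
  exact Finset.sum_congr rfl fun i _ => Finset.sum_congr rfl fun j _ => by ring

/-- The expected global reward `∑_{(i,j) ∈ E} x⁽ⁱ⁾ᵀ M x⁽ʲ⁾` of a joint arm. -/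
def globalReward {V : Type*} [Fintype V] (G : SimpleGraph V) [DecidableRel G.Adj] {d : ℕ}
    (M : Matrix (Fin d) (Fin d) ℝ) (x : V → Fin d → ℝ) : ℝ :=
  ∑ e ∈ edges G, edgeReward M (x e.1) (x e.2)

/-- The joint arm that gives `x` to the nodes of `V₁` and `x'` to the other nodes. -/
def allocate {V : Type*} [DecidableEq V] {d : ℕ} (V₁ : Finset V) (x x' : Fin d → ℝ) :
    V → Fin d → ℝ :=
  fun i => if i ∈ V₁ then x else x'

/-- `m_{1→2} z_{x x'} + m_{2→1} z_{x' x} + m₁ z_{x x} + m₂ z_{x' x'}`. -/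
def cutArm {V : Type*} [Fintype V] [DecidableEq V] (G : SimpleGraph V) [DecidableRel G.Adj]
    {d : ℕ} (V₁ V₂ : Finset V) (x x' : Fin d → ℝ) : Fin d × Fin d → ℝ :=
  (edgesFromTo G V₁ V₂ : ℝ) • edgeArm x x' + (edgesFromTo G V₂ V₁ : ℝ) • edgeArm x' x
    + (edgesFromTo G V₁ V₁ : ℝ) • edgeArm x x + (edgesFromTo G V₂ V₂ : ℝ) • edgeArm x' x'

/-- The `α`-pseudo-regret over the rounds `0, …, T - 1`, for an optimal joint arm `xopt` and the
joint arms `a t` that were played. -/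
def alphaRegret {V : Type*} [Fintype V] (G : SimpleGraph V) [DecidableRel G.Adj] {d : ℕ}
    (M : Matrix (Fin d) (Fin d) ℝ) (α : ℝ) (xopt : V → Fin d → ℝ) (a : ℕ → V → Fin d → ℝ)
    (T : ℕ) : ℝ :=
  ∑ t ∈ Finset.range T, (α * globalReward G M xopt - globalReward G M (a t))

/-! ### Regularized least squares and confidence sets

Rounds are numbered from `0`, so an index `t` means "after the `t` rounds `0, …, t - 1`". Below,
`a s` is the joint arm played in round `s` and `y s (i, j)` the reward observed on the edge
`(i, j)` in that round. -/

/-- `A_t = λ I + ∑_{s < t} ∑_{(i,j) ∈ E} z_s z_sᵀ`. -/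
def designMatrix {V : Type*} [Fintype V] (G : SimpleGraph V) [DecidableRel G.Adj] {d : ℕ}
    (lam : ℝ) (a : ℕ → V → Fin d → ℝ) (t : ℕ) : Matrix (Fin d × Fin d) (Fin d × Fin d) ℝ :=
  lam • (1 : Matrix (Fin d × Fin d) (Fin d × Fin d) ℝ) + ∑ s ∈ Finset.range t, ∑ e ∈ edges G,
    vecMulVec (edgeArm (a s e.1) (a s e.2)) (edgeArm (a s e.1) (a s e.2))

/-- The estimator `A_t⁻¹ b_t`, where `b_t = ∑_{s < t} ∑_{(i,j) ∈ E} y_s z_s`. -/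
def estimator {V : Type*} [Fintype V] (G : SimpleGraph V) [DecidableRel G.Adj] {d : ℕ}
    (lam : ℝ) (a : ℕ → V → Fin d → ℝ) (y : ℕ → V × V → ℝ) (t : ℕ) : Fin d × Fin d → ℝ :=
  (designMatrix G lam a t)⁻¹ *ᵥ
    ∑ s ∈ Finset.range t, ∑ e ∈ edges G, y s e • edgeArm (a s e.1) (a s e.2)

/-- `‖v‖_A = √(vᵀ A v)`. -/
def weightedNorm {ι : Type*} [Fintype ι] (A : Matrix ι ι ℝ) (v : ι → ℝ) : ℝ :=
  √(v ⬝ᵥ (A *ᵥ v))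

/-- `σ √(d² log((1 + t m L² / λ) / δ)) + √λ S`. -/
def confidenceRadius (d m : ℕ) (σ lam L S δ : ℝ) (t : ℕ) : ℝ :=
  σ * √((d : ℝ) ^ 2 * Real.log ((1 + t * m * L ^ 2 / lam) / δ)) + √lam * S

/-- The confidence ellipsoid `C_t(δ)` around the estimator. -/
def confidenceSet {V : Type*} [Fintype V] (G : SimpleGraph V) [DecidableRel G.Adj] {d : ℕ}
    (σ lam L S δ : ℝ) (a : ℕ → V → Fin d → ℝ) (y : ℕ → V × V → ℝ) (t : ℕ) :
    Set (Fin d × Fin d → ℝ) :=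
  {θ | weightedNorm (designMatrix G lam a t) (θ - estimator G lam a y t)
        ≤ confidenceRadius d (edges G).card σ lam L S δ t}

/-! ### The noise and the algorithm -/

/-- The noise is conditionally centred and `σ`-sub-Gaussian: the noise of round `t` is known after
that round, and, given the past `ℱ t`, its linear combinations over the edges obey the sub-Gaussian
bound that independent centred `σ`-sub-Gaussian variables obey. -/
structure IsSubGaussianNoise {V Ω : Type*} [Fintype V] (G : SimpleGraph V) [DecidableRel G.Adj]
    {mΩ : MeasurableSpace Ω} (μ : Measure Ω) (ℱ : Filtration ℕ mΩ) (σ : ℝ)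
    (η : ℕ → V × V → Ω → ℝ) : Prop where
  measurable : ∀ t, ∀ e ∈ edges G, Measurable[ℱ (t + 1)] (η t e)
  integrable : ∀ t (c : V × V → ℝ),
    Integrable (fun ω => Real.exp (∑ e ∈ edges G, c e * η t e ω)) μ
  condExp_le : ∀ t (c : V × V → ℝ),
    μ[fun ω => Real.exp (∑ e ∈ edges G, c e * η t e ω) | ℱ t]
      ≤ᵐ[μ] fun _ => Real.exp (σ ^ 2 * (∑ e ∈ edges G, c e ^ 2) / 2)

/-- The rewards `y_t^{(i,j)} = x_t^{(i)ᵀ} M x_t^{(j)} + η_t^{(i,j)}`. -/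
def observedReward {V Ω : Type*} {d : ℕ} (M : Matrix (Fin d) (Fin d) ℝ)
    (η : ℕ → V × V → Ω → ℝ) (a : ℕ → V → Fin d → ℝ) (ω : Ω) : ℕ → V × V → ℝ :=
  fun s e => edgeReward M (a s e.1) (a s e.2) + η s e ω

/-- `(x t, x' t)`, `t < T`, are the pairs chosen in a run of the improved OFUL algorithm with the
cut `(V₁, V₂)`: in each round the pair is a function of the past and is, together with some `θ` in
the current confidence set, a maximizer of `⟨m_{1→2} z_{y y'} + m_{2→1} z_{y' y} + m₁ z_{y y} +
m₂ z_{y' y'}, θ'⟩` over all pairs of arms `y, y'` and all `θ'` in the confidence set. The nodes of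
`V₁` then play `x t` and those of `V₂` play `x' t`. Ties are broken arbitrarily. -/
structure IsImprovedOFULRun {V Ω : Type*} [Fintype V] [DecidableEq V] (G : SimpleGraph V)
    [DecidableRel G.Adj] {mΩ : MeasurableSpace Ω} (ℱ : Filtration ℕ mΩ) {d : ℕ}
    (X : Finset (Fin d → ℝ)) (M : Matrix (Fin d) (Fin d) ℝ) (η : ℕ → V × V → Ω → ℝ)
    (V₁ V₂ : Finset V) (σ lam L S δ : ℝ) (T : ℕ) (x x' : ℕ → Ω → Fin d → ℝ) : Prop where
  measurable_fst : ∀ t < T, Measurable[ℱ t] (x t)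
  measurable_snd : ∀ t < T, Measurable[ℱ t] (x' t)
  mem_fst : ∀ t < T, ∀ ω, x t ω ∈ X
  mem_snd : ∀ t < T, ∀ ω, x' t ω ∈ X
  optimistic : ∀ t < T, ∀ ω,
    let a : ℕ → V → Fin d → ℝ := fun s => allocate V₁ (x s ω) (x' s ω)
    let C : Set (Fin d × Fin d → ℝ) :=
      confidenceSet G σ lam L S δ a (observedReward M η a ω) t
    ∃ θ ∈ C, ∀ y ∈ X, ∀ y' ∈ X, ∀ θ' ∈ C,
      cutArm G V₁ V₂ y y' ⬝ᵥ θ' ≤ cutArm G V₁ V₂ (x t ω) (x' t ω) ⬝ᵥ θ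

/-- The regret bound
`√(32 T m d² max(2, (LS)²) log(1 + T m L² / (λ d²))) (σ √(d² log((1 + T m L² / λ) / δ)) + √λ S)`
`+ L S m ⌈d² log₂((T m L² / λ) / δ)⌉`, where a negative last factor counts as `0`. -/
def regretBound (d m T : ℕ) (σ lam L S δ : ℝ) : ℝ :=
  √(32 * T * m * (d : ℝ) ^ 2 * max 2 ((L * S) ^ 2)
      * Real.log (1 + T * m * L ^ 2 / lam / (d : ℝ) ^ 2))
    * (σ * √((d : ℝ) ^ 2 * Real.log ((1 + T * m * L ^ 2 / lam) / δ)) + √lam * S)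
  + L * S * m * (⌈(d : ℝ) ^ 2 * Real.logb 2 (T * m * L ^ 2 / lam / δ)⌉₊ : ℝ)

end

end GraphicalBilinear

/-!
On the event that `vec M` lies in all confidence sets, optimism bounds the `α`-regret of a round by
the width of the confidence set in the direction of the played batch of edge-arms, provided that
`α OPT` is at most the best value attainable by a cut allocation.

That event has probability at least `1 - δ`: integrating the exponential supermartingales
`exp ⟨u, S_t⟩ - …` of the noise against a Gaussian density in `u` gives a nonnegative
supermartingale, whose value is explicit in `‖S_t‖_{A_t⁻¹}` and `det A_t`, and Ville's inequality
bounds it uniformly in time. The widths are summed by the elliptical potential argument, for whole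
batches: `det (A + ∑ z zᵀ) ≥ det A * (1 + ∑ ‖z‖²_{A⁻¹})`, so that the product of the factors
`1 + w_t` of the rounds is at most `det A_T / det A_0`. This controls the sum of the widths
`w_t ≤ 1` as well as the number of rounds with `w_t > 1`, in which the regret is bounded trivially.

For the approximation ratio, averaging over the two directions of each edge shows that the best
pair earns at least the average optimal reward on every cut edge, while an uncut edge costs at most
the fraction `1 - γ`.
-/

namespace GraphicalBilinear

section WeightedNorm

variable {ι : Type*} [Fintype ι] {A : Matrix ι ι ℝ}

theorem sq_weightedNorm (hA : A.PosSemidef) (v : ι → ℝ) :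
    weightedNorm A v ^ 2 = v ⬝ᵥ (A *ᵥ v) :=
  Real.sq_sqrt (by simpa using hA.dotProduct_mulVec_nonneg v)

theorem dotProduct_self_eq_sq_norm (v : ι → ℝ) : v ⬝ᵥ v = ‖WithLp.toLp 2 v‖ ^ 2 := by
  rw [EuclideanSpace.real_norm_sq_eq, dotProduct]
  simp only [sq]

theorem weightedNorm_smul (A : Matrix ι ι ℝ) (c : ℝ) (v : ι → ℝ) :
    weightedNorm A (c • v) = |c| * weightedNorm A v := by
  rw [weightedNorm, weightedNorm, mulVec_smul, smul_dotProduct, dotProduct_smul, smul_smul,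
    smul_eq_mul, Real.sqrt_mul (mul_self_nonneg c), Real.sqrt_mul_self_eq_abs]

theorem weightedNorm_neg (A : Matrix ι ι ℝ) (v : ι → ℝ) :
    weightedNorm A (-v) = weightedNorm A v := by
  rw [← neg_one_smul ℝ, weightedNorm_smul, abs_neg, abs_one, one_mul]

theorem weightedNorm_transpose_mul_self (B : Matrix ι ι ℝ) (v : ι → ℝ) :
    weightedNorm (Bᵀ * B) v = ‖WithLp.toLp 2 (B *ᵥ v)‖ := by
  rw [weightedNorm, ← mulVec_mulVec, dotProduct_mulVec, vecMul_transpose,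
    dotProduct_self_eq_sq_norm, Real.sqrt_sq (norm_nonneg _)]

variable [DecidableEq ι]

theorem weightedNorm_inv_transpose_mul_self (B : Matrix ι ι ℝ) (v : ι → ℝ) :
    weightedNorm (Bᵀ * B)⁻¹ v = ‖WithLp.toLp 2 (Bᵀ⁻¹ *ᵥ v)‖ := by
  rw [Matrix.mul_inv_rev, ← weightedNorm_transpose_mul_self, transpose_nonsing_inv,
    transpose_transpose]

open scoped MatrixOrder in
theorem exists_eq_transpose_mul_self (hA : A.PosDef) :
    ∃ B : Matrix ι ι ℝ, A = Bᵀ * B ∧ IsUnit B.det := by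
  obtain ⟨B, hB⟩ := CStarAlgebra.nonneg_iff_eq_star_mul_self.mp hA.posSemidef.nonneg
  rw [star_eq_conjTranspose, conjTranspose_eq_transpose_of_trivial] at hB
  refine ⟨B, hB, isUnit_iff_ne_zero.2 fun h => hA.det_pos.ne' ?_⟩
  rw [hB, det_mul, h, mul_zero]

theorem abs_dotProduct_le_weightedNorm_mul (hA : A.PosDef) (z v : ι → ℝ) :
    |z ⬝ᵥ v| ≤ weightedNorm A⁻¹ z * weightedNorm A v := by
  obtain ⟨B, rfl, hB⟩ := exists_eq_transpose_mul_self hA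
  have hz : z ⬝ᵥ v = (Bᵀ⁻¹ *ᵥ z) ⬝ᵥ (B *ᵥ v) := by
    rw [← vecMul_transpose, ← dotProduct_mulVec, mulVec_mulVec, transpose_nonsing_inv,
      transpose_transpose, Matrix.nonsing_inv_mul _ hB, one_mulVec]
  rw [hz, weightedNorm_inv_transpose_mul_self, weightedNorm_transpose_mul_self, mul_comm]
  simpa [EuclideanSpace.inner_eq_star_dotProduct] using
    abs_real_inner_le_norm (WithLp.toLp 2 (B *ᵥ v)) (WithLp.toLp 2 (Bᵀ⁻¹ *ᵥ z))

omit [DecidableEq ι] in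
theorem weightedNorm_add_le (hA : A.PosDef) (u v : ι → ℝ) :
    weightedNorm A (u + v) ≤ weightedNorm A u + weightedNorm A v := by
  classical
  obtain ⟨B, rfl, -⟩ := exists_eq_transpose_mul_self hA
  simp only [weightedNorm_transpose_mul_self, mulVec_add, WithLp.toLp_add]
  exact norm_add_le _ _

theorem weightedNorm_inv_mulVec (hA : A.PosDef) (v : ι → ℝ) :
    weightedNorm A (A⁻¹ *ᵥ v) = weightedNorm A⁻¹ v := by
  rw [weightedNorm, weightedNorm, mulVec_mulVec, Matrix.mul_nonsing_inv _ hA.det_pos.ne'.isUnit,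
    one_mulVec, dotProduct_comm]

end WeightedNorm

section Determinant

variable {ι κ : Type*}

theorem one_add_sum_le_prod_one_add (s : Finset κ) {f : κ → ℝ} (hf : ∀ i ∈ s, 0 ≤ f i) :
    1 + ∑ i ∈ s, f i ≤ ∏ i ∈ s, (1 + f i) := by
  induction s using Finset.cons_induction with
  | empty => simp
  | cons a s ha ih =>
    rw [Finset.forall_mem_cons] at hf
    rw [Finset.sum_cons, Finset.prod_cons]
    nlinarith [ih hf.2, hf.1, Finset.sum_nonneg hf.2]

theorem posSemidef_sum_vecMulVec_self [Finite ι] (s : Finset κ) (z : κ → ι → ℝ) :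
    (∑ k ∈ s, vecMulVec (z k) (z k)).PosSemidef :=
  posSemidef_sum s fun k _ => by simpa using posSemidef_vecMulVec_self_star (z k)

variable [Fintype ι] [DecidableEq ι]

theorem det_one_add_eq_prod_eigenvalues {K : Matrix ι ι ℝ} (hK : K.IsHermitian) :
    (1 + K).det = ∏ i, (1 + hK.eigenvalues i) := by
  have h := congrArg (Polynomial.eval (-1)) hK.charpoly_eq
  simp only [eval_charpoly, Polynomial.eval_prod, Polynomial.eval_sub, Polynomial.eval_X,
    Polynomial.eval_C, map_neg, map_one, ← neg_add', det_neg, Finset.prod_neg,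
    Finset.card_univ] at h
  exact mul_left_cancel₀ (pow_ne_zero _ (neg_ne_zero.2 one_ne_zero)) h

theorem one_add_trace_le_det_one_add {K : Matrix ι ι ℝ} (hK : K.PosSemidef) :
    1 + K.trace ≤ (1 + K).det := by
  rw [det_one_add_eq_prod_eigenvalues hK.1, hK.1.trace_eq_sum_eigenvalues]
  exact one_add_sum_le_prod_one_add _ fun i _ => hK.eigenvalues_nonneg i

theorem det_mul_one_add_sum_le {A : Matrix ι ι ℝ} (hA : A.PosDef) (s : Finset κ)
    (z : κ → ι → ℝ) :
    A.det * (1 + ∑ k ∈ s, weightedNorm A⁻¹ (z k) ^ 2)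
      ≤ (A + ∑ k ∈ s, vecMulVec (z k) (z k)).det := by
  obtain ⟨B, rfl, hB⟩ := exists_eq_transpose_mul_self hA
  let w : κ → ι → ℝ := fun k => Bᵀ⁻¹ *ᵥ z k
  let K := ∑ k ∈ s, vecMulVec (w k) (w k)
  have hz (k : κ) : z k = Bᵀ *ᵥ w k := by
    rw [mulVec_mulVec, Matrix.mul_nonsing_inv _ (by rwa [det_transpose]), one_mulVec]
  have hconj : Bᵀ * B + ∑ k ∈ s, vecMulVec (z k) (z k) = Bᵀ * (1 + K) * B := by
    simp only [K, mul_add, add_mul, mul_one, Finset.mul_sum, Finset.sum_mul, mul_vecMulVec,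
      vecMulVec_mul, ← mulVec_transpose, ← hz]
  have htrace : ∑ k ∈ s, weightedNorm (Bᵀ * B)⁻¹ (z k) ^ 2 = K.trace := by
    simp only [K, trace_sum, trace_vecMulVec, weightedNorm_inv_transpose_mul_self,
      dotProduct_self_eq_sq_norm, w]
  calc (Bᵀ * B).det * (1 + ∑ k ∈ s, weightedNorm (Bᵀ * B)⁻¹ (z k) ^ 2)
      = (B.det * B.det) * (1 + K.trace) := by rw [htrace, det_mul, det_transpose]
    _ ≤ (B.det * B.det) * (1 + K).det := mul_le_mul_of_nonneg_left
      (one_add_trace_le_det_one_add (posSemidef_sum_vecMulVec_self s w)) (mul_self_nonneg _)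
    _ = (Bᵀ * B + ∑ k ∈ s, vecMulVec (z k) (z k)).det := by
      rw [hconj, det_mul, det_mul, det_transpose, mul_right_comm]

theorem det_le_trace_div_card_pow [Nonempty ι] {A : Matrix ι ι ℝ} (hA : A.PosSemidef) :
    A.det ≤ (A.trace / Fintype.card ι) ^ Fintype.card ι := by
  have hnonneg (i : ι) (_ : i ∈ Finset.univ) : 0 ≤ hA.1.eigenvalues i := hA.eigenvalues_nonneg i
  have hcard : (0 : ℝ) < Fintype.card ι := by exact_mod_cast Fintype.card_pos
  have amgm := Real.geom_mean_le_arith_mean Finset.univ (fun _ : ι => (1 : ℝ)) hA.1.eigenvalues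
    (fun _ _ => zero_le_one) (by simpa using hcard) hnonneg
  simp only [Real.rpow_one, one_mul, Finset.sum_const, Finset.card_univ, nsmul_eq_mul,
    mul_one] at amgm
  calc A.det = ∏ i, hA.1.eigenvalues i := hA.1.det_eq_prod_eigenvalues
    _ = ((∏ i, hA.1.eigenvalues i) ^ (Fintype.card ι : ℝ)⁻¹) ^ Fintype.card ι :=
      (Real.rpow_inv_natCast_pow (Finset.prod_nonneg hnonneg) Fintype.card_ne_zero).symm
    _ ≤ ((∑ i, hA.1.eigenvalues i) / Fintype.card ι) ^ Fintype.card ι :=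
      pow_le_pow_left₀ (Real.rpow_nonneg (Finset.prod_nonneg hnonneg) _) amgm _
    _ = (A.trace / Fintype.card ι) ^ Fintype.card ι := by
      rw [hA.1.trace_eq_sum_eigenvalues]; rfl

end Determinant

section GramMatrix

variable {ι κ : Type*} [DecidableEq ι]

/-- The regularized Gram matrix `lam • 1 + ∑ k ∈ s, z k (z k)ᵀ` of a finite family of feature
vectors, that is, the design matrix of ridge regression. -/
def gramMatrix (lam : ℝ) (s : Finset κ) (z : κ → ι → ℝ) : Matrix ι ι ℝ :=
  lam • 1 + ∑ k ∈ s, vecMulVec (z k) (z k)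

theorem gramMatrix_empty (lam : ℝ) (z : κ → ι → ℝ) : gramMatrix lam ∅ z = lam • 1 := by
  rw [gramMatrix, Finset.sum_empty, add_zero]

theorem gramMatrix_range_succ_product (lam : ℝ) (t : ℕ) (E : Finset κ) (z : ℕ × κ → ι → ℝ) :
    gramMatrix lam (Finset.range (t + 1) ×ˢ E) z
      = gramMatrix lam (Finset.range t ×ˢ E) z
        + ∑ e ∈ E, vecMulVec (z (t, e)) (z (t, e)) := by
  rw [gramMatrix, gramMatrix, Finset.sum_product, Finset.sum_product, Finset.sum_range_succ,
    add_assoc]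

variable [Fintype ι]

theorem dotProduct_gramMatrix_mulVec (lam : ℝ) (s : Finset κ) (z : κ → ι → ℝ) (u : ι → ℝ) :
    u ⬝ᵥ (gramMatrix lam s z *ᵥ u) = lam * (u ⬝ᵥ u) + ∑ k ∈ s, (u ⬝ᵥ z k) ^ 2 := by
  simp only [gramMatrix, add_mulVec, smul_mulVec, one_mulVec, sum_mulVec, vecMulVec_mulVec,
    dotProduct_add, dotProduct_smul, dotProduct_sum, smul_eq_mul, MulOpposite.smul_eq_mul_unop,
    MulOpposite.unop_op, sq, dotProduct_comm]

variable {lam : ℝ} (hlam : 0 < lam)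
include hlam

omit [Fintype ι] in
theorem posDef_gramMatrix [Finite ι] (s : Finset κ) (z : κ → ι → ℝ) :
    (gramMatrix lam s z).PosDef :=
  (PosDef.one.smul hlam).add_posSemidef (posSemidef_sum_vecMulVec_self s z)

theorem mul_sq_weightedNorm_inv_gramMatrix_le (s : Finset κ) (z : κ → ι → ℝ) (u : ι → ℝ) :
    lam * weightedNorm (gramMatrix lam s z)⁻¹ u ^ 2 ≤ ‖WithLp.toLp 2 u‖ ^ 2 := by
  have hA := posDef_gramMatrix hlam s z
  let v := (gramMatrix lam s z)⁻¹ *ᵥ u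
  have huv : weightedNorm (gramMatrix lam s z)⁻¹ u ^ 2 = u ⬝ᵥ v :=
    sq_weightedNorm hA.inv.posSemidef u
  have hv : lam * (v ⬝ᵥ v) ≤ u ⬝ᵥ v := by
    rw [← huv, ← weightedNorm_inv_mulVec hA, sq_weightedNorm hA.posSemidef,
      dotProduct_gramMatrix_mulVec]
    exact le_add_of_nonneg_right (Finset.sum_nonneg fun _ _ => sq_nonneg _)
  have hnonneg : 0 ≤ (u - lam • v) ⬝ᵥ (u - lam • v) := by
    rw [dotProduct_self_eq_sq_norm]; positivity
  simp only [sub_dotProduct, dotProduct_sub, smul_dotProduct, dotProduct_smul, smul_eq_mul,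
    dotProduct_comm v u] at hnonneg
  rw [huv, ← dotProduct_self_eq_sq_norm]
  nlinarith [mul_le_mul_of_nonneg_left hv hlam.le]

theorem det_gramMatrix_le [Nonempty ι] {s : Finset κ} {z : κ → ι → ℝ} {L : ℝ}
    (hz : ∀ k ∈ s, ‖WithLp.toLp 2 (z k)‖ ≤ L) :
    (gramMatrix lam s z).det ≤ lam ^ Fintype.card ι
      * (1 + s.card * L ^ 2 / lam / Fintype.card ι) ^ Fintype.card ι := by
  have hA := (posDef_gramMatrix hlam s z).posSemidef
  have hcard : (0 : ℝ) < Fintype.card ι := by exact_mod_cast Fintype.card_pos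
  have htrace : (gramMatrix lam s z).trace ≤ lam * Fintype.card ι + s.card * L ^ 2 := by
    rw [gramMatrix, trace_add, trace_smul, trace_one, smul_eq_mul, trace_sum, ← nsmul_eq_mul]
    gcongr
    refine Finset.sum_le_card_nsmul _ _ _ fun k hk => ?_
    rw [trace_vecMulVec, dotProduct_self_eq_sq_norm]
    exact pow_le_pow_left₀ (norm_nonneg _) (hz k hk) 2
  calc (gramMatrix lam s z).det
      ≤ ((gramMatrix lam s z).trace / Fintype.card ι) ^ Fintype.card ι :=
        det_le_trace_div_card_pow hA
    _ ≤ ((lam * Fintype.card ι + s.card * L ^ 2) / Fintype.card ι) ^ Fintype.card ι :=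
        pow_le_pow_left₀ (div_nonneg hA.trace_nonneg hcard.le) (by gcongr) _
    _ = _ := by rw [← mul_pow]; field_simp

theorem weightedNorm_sub_ridge_le (s : Finset κ) (z : κ → ι → ℝ) (n : κ → ℝ) (θ : ι → ℝ) :
    weightedNorm (gramMatrix lam s z)
        (θ - (gramMatrix lam s z)⁻¹ *ᵥ ∑ k ∈ s, (z k ⬝ᵥ θ + n k) • z k)
      ≤ weightedNorm (gramMatrix lam s z)⁻¹ (∑ k ∈ s, n k • z k)
        + √lam * ‖WithLp.toLp 2 θ‖ := by
  have hA := posDef_gramMatrix hlam s z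
  have hresponse : ∑ k ∈ s, (z k ⬝ᵥ θ + n k) • z k
      = gramMatrix lam s z *ᵥ θ - lam • θ + ∑ k ∈ s, n k • z k := by
    simp only [gramMatrix, add_mulVec, smul_mulVec, one_mulVec, add_sub_cancel_left, sum_mulVec,
      vecMulVec_mulVec, add_smul, Finset.sum_add_distrib, op_smul_eq_smul]
  have herror : θ - (gramMatrix lam s z)⁻¹ *ᵥ ∑ k ∈ s, (z k ⬝ᵥ θ + n k) • z k
      = (gramMatrix lam s z)⁻¹ *ᵥ (-(∑ k ∈ s, n k • z k) + lam • θ) := by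
    rw [hresponse, mulVec_add, mulVec_add, mulVec_sub, mulVec_mulVec,
      Matrix.nonsing_inv_mul _ hA.det_pos.ne'.isUnit, one_mulVec, mulVec_neg]
    abel
  have hbias : weightedNorm (gramMatrix lam s z)⁻¹ (lam • θ) ≤ √lam * ‖WithLp.toLp 2 θ‖ := by
    have hθ := mul_sq_weightedNorm_inv_gramMatrix_le hlam s z (lam • θ)
    rw [WithLp.toLp_smul, norm_smul, Real.norm_of_nonneg hlam.le] at hθ
    refine le_of_sq_le_sq ?_ (by positivity)
    rw [mul_pow, Real.sq_sqrt hlam.le]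
    nlinarith
  rw [herror, weightedNorm_inv_mulVec hA]
  refine (weightedNorm_add_le hA.inv _ _).trans ?_
  rw [weightedNorm_neg]
  gcongr

theorem pow_mul_prod_one_add_le_det_gramMatrix (t : ℕ) (E : Finset κ) (z : ℕ × κ → ι → ℝ) :
    lam ^ Fintype.card ι * ∏ s ∈ Finset.range t,
        (1 + ∑ e ∈ E, weightedNorm (gramMatrix lam (Finset.range s ×ˢ E) z)⁻¹ (z (s, e)) ^ 2)
      ≤ (gramMatrix lam (Finset.range t ×ˢ E) z).det := by
  induction t with
  | zero => simp [gramMatrix_empty]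
  | succ t ih =>
    rw [Finset.prod_range_succ, ← mul_assoc, gramMatrix_range_succ_product]
    refine le_trans ?_ (det_mul_one_add_sum_le (posDef_gramMatrix hlam _ z) E _)
    exact mul_le_mul_of_nonneg_right ih (by positivity)

end GramMatrix

section GaussianIntegral

variable {ι : Type*} [Fintype ι]

theorem lintegral_exp_neg_dotProduct_self_ne_zero :
    ∫⁻ v : ι → ℝ, ENNReal.ofReal (Real.exp (-(v ⬝ᵥ v) / 2)) ≠ 0 := by
  have hmeas : Measurable fun v : ι → ℝ => ENNReal.ofReal (Real.exp (-(v ⬝ᵥ v) / 2)) := by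
    unfold dotProduct; fun_prop
  refine ((lintegral_pos_iff_support hmeas).2 ?_).ne'
  rw [Function.support_eq_univ fun v => (ENNReal.ofReal_pos.2 (Real.exp_pos _)).ne']
  exact NeZero.pos _

theorem lintegral_exp_neg_dotProduct_self_ne_top :
    ∫⁻ v : ι → ℝ, ENNReal.ofReal (Real.exp (-(v ⬝ᵥ v) / 2)) ≠ ⊤ := by
  have hint : Integrable (fun v : ι → ℝ => ∏ i, Real.exp (-(1 / 2) * v i ^ 2)) volume :=
    Integrable.fintype_prod fun _ => integrable_exp_neg_mul_sq (by norm_num)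
  have hprod (v : ι → ℝ) :
      Real.exp (-(v ⬝ᵥ v) / 2) = ∏ i, Real.exp (-(1 / 2) * v i ^ 2) := by
    rw [← Real.exp_sum, ← Finset.mul_sum, dotProduct]
    simp only [← sq]
    congr 1; ring
  simp only [hprod]
  exact hint.lintegral_lt_top.ne

variable [DecidableEq ι] {A : Matrix ι ι ℝ} (hA : A.PosDef)
include hA

theorem dotProduct_sub_half_dotProduct_mulVec (s u : ι → ℝ) :
    u ⬝ᵥ s - u ⬝ᵥ (A *ᵥ u) / 2
      = weightedNorm A⁻¹ s ^ 2 / 2 + -weightedNorm A (u - A⁻¹ *ᵥ s) ^ 2 / 2 := by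
  have hAu : A *ᵥ (A⁻¹ *ᵥ s) = s := by
    rw [mulVec_mulVec, Matrix.mul_nonsing_inv _ hA.det_pos.ne'.isUnit, one_mulVec]
  have hsymm (v : ι → ℝ) : (A⁻¹ *ᵥ s) ⬝ᵥ (A *ᵥ v) = s ⬝ᵥ v := by
    rw [dotProduct_mulVec, ← mulVec_transpose, ← conjTranspose_eq_transpose_of_trivial,
      hA.isHermitian.eq, hAu]
  rw [sq_weightedNorm hA.posSemidef, sq_weightedNorm hA.inv.posSemidef, mulVec_sub, hAu,
    sub_dotProduct, dotProduct_sub, dotProduct_sub, hsymm, dotProduct_comm (A⁻¹ *ᵥ s) s,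
    dotProduct_comm s u]
  ring

theorem lintegral_exp_neg_sq_weightedNorm :
    ∫⁻ u : ι → ℝ, ENNReal.ofReal (Real.exp (-weightedNorm A u ^ 2 / 2))
      = ENNReal.ofReal (√A.det)⁻¹
        * ∫⁻ v : ι → ℝ, ENNReal.ofReal (Real.exp (-(v ⬝ᵥ v) / 2)) := by
  obtain ⟨B, rfl, hB⟩ := exists_eq_transpose_mul_self hA
  have hmeas : Measurable fun v : ι → ℝ => ENNReal.ofReal (Real.exp (-(v ⬝ᵥ v) / 2)) := by
    unfold dotProduct; fun_prop
  have hmap := lintegral_map (μ := volume) hmeas (toLin' B).continuous_on_pi.measurable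
  rw [Real.map_matrix_volume_pi_eq_smul_volume_pi hB.ne_zero, lintegral_smul_measure] at hmap
  simp only [weightedNorm_transpose_mul_self, ← dotProduct_self_eq_sq_norm]
  rw [det_mul, det_transpose, Real.sqrt_mul_self_eq_abs, ← abs_inv]
  exact hmap.symm

theorem lintegral_exp_dotProduct_sub_half_dotProduct_mulVec (s : ι → ℝ) :
    ∫⁻ u : ι → ℝ, ENNReal.ofReal (Real.exp (u ⬝ᵥ s - u ⬝ᵥ (A *ᵥ u) / 2))
      = ENNReal.ofReal (Real.exp (weightedNorm A⁻¹ s ^ 2 / 2)) * (ENNReal.ofReal (√A.det)⁻¹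
        * ∫⁻ v : ι → ℝ, ENNReal.ofReal (Real.exp (-(v ⬝ᵥ v) / 2))) := by
  simp_rw [dotProduct_sub_half_dotProduct_mulVec hA, Real.exp_add,
    ENNReal.ofReal_mul (Real.exp_nonneg _)]
  rw [lintegral_const_mul' _ _ ENNReal.ofReal_ne_top, ← lintegral_exp_neg_sq_weightedNorm hA,
    lintegral_sub_right_eq_self
      (fun u => ENNReal.ofReal (Real.exp (-weightedNorm A u ^ 2 / 2))) (A⁻¹ *ᵥ s)]

end GaussianIntegral

section MaximalInequality

open scoped ENNReal

variable {Ω : Type*} {mΩ : MeasurableSpace Ω} {μ : Measure Ω}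

variable {ℱ : Filtration ℕ mΩ} {W : ℕ → Ω → ℝ≥0∞} {T : ℕ} (hW : ∀ t ≤ T, Measurable[ℱ t] (W t))
  (hsup : ∀ t < T, ∀ B, MeasurableSet[ℱ t] B →
    ∫⁻ ω in B, W (t + 1) ω ∂μ ≤ ∫⁻ ω in B, W t ω ∂μ) (c : ℝ≥0∞)
include hW hsup

theorem mul_measure_inter_exists_le_le_setLIntegral {s n : ℕ} (hsn : s + n ≤ T) {B : Set Ω}
    (hB : MeasurableSet[ℱ s] B) :
    c * μ (B ∩ {ω | ∃ k ≤ n, c ≤ W (s + k) ω}) ≤ ∫⁻ ω in B, W s ω ∂μ := by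
  induction n generalizing s B with
  | zero =>
    have hzero : B ∩ {ω | ∃ k ≤ 0, c ≤ W (s + k) ω} ⊆ {ω | c ≤ W s ω} ∩ B := by
      rintro ω ⟨hω, k, hk, hc⟩
      obtain rfl := Nat.le_zero.1 hk
      exact ⟨hc, hω⟩
    have hm := (hW s (by omega)).mono (ℱ.le s) le_rfl
    calc c * μ (B ∩ {ω | ∃ k ≤ 0, c ≤ W (s + k) ω})
        ≤ c * μ.restrict B {ω | c ≤ W s ω} := by
          rw [Measure.restrict_apply (measurableSet_le measurable_const hm)]; gcongr
      _ ≤ ∫⁻ ω in B, W s ω ∂μ := mul_meas_ge_le_lintegral hm c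
  | succ n ih =>
    let N := {ω | c ≤ W s ω}
    let D := {ω | ∃ k ≤ n, c ≤ W (s + 1 + k) ω}
    have hN : MeasurableSet[ℱ s] N := hW s (by omega) measurableSet_Ici
    have hsplit : B ∩ {ω | ∃ k ≤ n + 1, c ≤ W (s + k) ω} ⊆ B ∩ N ∪ (B \ N) ∩ D := by
      rintro ω ⟨hω, k, hk, hc⟩
      by_cases hωN : ω ∈ N
      · exact Or.inl ⟨hω, hωN⟩
      · obtain _ | k := k
        · exact absurd hc hωN
        · exact Or.inr ⟨⟨hω, hωN⟩, k, by omega, by rwa [add_assoc, add_comm 1]⟩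
    calc c * μ (B ∩ {ω | ∃ k ≤ n + 1, c ≤ W (s + k) ω})
        ≤ c * (μ (B ∩ N) + μ ((B \ N) ∩ D)) := by
          gcongr; exact (measure_mono hsplit).trans (measure_union_le _ _)
      _ ≤ ∫⁻ ω in B ∩ N, W s ω ∂μ + ∫⁻ ω in B \ N, W (s + 1) ω ∂μ := by
          rw [mul_add, ← setLIntegral_const]
          gcongr ?_ + ?_
          · exact setLIntegral_mono' (ℱ.le s _ (hB.inter hN)) fun ω hω => hω.2
          · exact ih (by omega) (ℱ.mono s.le_succ _ (hB.diff hN))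
      _ ≤ ∫⁻ ω in B ∩ N, W s ω ∂μ + ∫⁻ ω in B \ N, W s ω ∂μ := by
          gcongr 1; exact hsup s (by omega) _ (hB.diff hN)
      _ = ∫⁻ ω in B, W s ω ∂μ := lintegral_inter_add_sdiff _ _ (ℱ.le s _ hN)

/- Ville's maximal inequality. -/
theorem mul_measure_exists_le_le_lintegral :
    c * μ {ω | ∃ t ≤ T, c ≤ W t ω} ≤ ∫⁻ ω, W 0 ω ∂μ := by
  simpa using mul_measure_inter_exists_le_le_setLIntegral hW hsup c (zero_add T).le
    MeasurableSet.univ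

end MaximalInequality

section SubGaussianNoise

open scoped ENNReal Topology
open Filter

/-- The exponential tilt `exp (∑ e ∈ E, (c e * x e - σ² * (c e)² / 2))` with coefficients `c`,
whose conditional expectation is at most `1` if `x` is `σ`-sub-Gaussian noise. -/
noncomputable def expTilt {κ : Type*} (E : Finset κ) (σ : ℝ) (c x : κ → ℝ) : ℝ≥0∞ :=
  ENNReal.ofReal (Real.exp (∑ e ∈ E, (c e * x e - σ ^ 2 * c e ^ 2 / 2)))

theorem expTilt_eq_mul {κ : Type*} (E : Finset κ) (σ : ℝ) (c x : κ → ℝ) :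
    expTilt E σ c x = ENNReal.ofReal (Real.exp (∑ e ∈ E, c e * x e))
      * ENNReal.ofReal (Real.exp (-(σ ^ 2 * (∑ e ∈ E, c e ^ 2) / 2))) := by
  rw [expTilt, Finset.sum_sub_distrib, sub_eq_add_neg, Real.exp_add,
    ENNReal.ofReal_mul (Real.exp_nonneg _), Finset.mul_sum, Finset.sum_div]

theorem continuous_expTilt {κ : Type*} (E : Finset κ) (σ : ℝ) (x : κ → ℝ) :
    Continuous fun c => expTilt E σ c x :=
  ENNReal.continuous_ofReal.comp (by fun_prop)

theorem measurable_expTilt {α κ : Type*} [MeasurableSpace α] {E : Finset κ} {σ : ℝ}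
    {c x : α → κ → ℝ} (hc : ∀ e ∈ E, Measurable fun a => c a e)
    (hx : ∀ e ∈ E, Measurable fun a => x a e) :
    Measurable fun a => expTilt E σ (c a) (x a) := by
  refine (Real.measurable_exp.comp (Finset.measurable_fun_sum _ fun e he => ?_)).ennreal_ofReal
  exact ((hc e he).mul (hx e he)).sub ((((hc e he).pow_const 2).const_mul _).div_const 2)

theorem exists_tendsto_of_measurable {α κ : Type*} {_ : MeasurableSpace α} [Finite κ]
    {c : α → κ → ℝ} (hc : Measurable c) :
    ∃ C : ℕ → α → κ → ℝ, (∀ n, Measurable (C n)) ∧ (∀ n, (Set.range (C n)).Finite) ∧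
      ∀ a, Tendsto (C · a) atTop (𝓝 (c a)) :=
  have hsm := hc.stronglyMeasurable
  ⟨fun n => hsm.approx n, fun n => (hsm.approx n).measurable, fun n => (hsm.approx n).finite_range,
    hsm.tendsto_approx⟩

variable {Ω : Type*} {mΩ : MeasurableSpace Ω} {μ : Measure Ω}

theorem lintegral_mul_le_of_condExp_le [IsFiniteMeasure μ] {m : MeasurableSpace Ω} (hm : m ≤ mΩ)
    {g : Ω → ℝ} (hg : Integrable g μ) (hg0 : ∀ ω, 0 ≤ g ω) {K : ℝ}
    (hK : μ[g | m] ≤ᵐ[μ] fun _ => K) {f : Ω → ℝ≥0∞} (hf : Measurable[m] f) :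
    ∫⁻ ω, f ω * ENNReal.ofReal (g ω) ∂μ ≤ ENNReal.ofReal K * ∫⁻ ω, f ω ∂μ := by
  let ν := μ.withDensity fun ω => ENNReal.ofReal (g ω)
  have hdensity : AEMeasurable (fun ω => ENNReal.ofReal (g ω)) μ := hg.aemeasurable.ennreal_ofReal
  have htrim : ν.trim hm ≤ (ENNReal.ofReal K • μ).trim hm := by
    refine Measure.le_iff.2 fun s hs => ?_
    have hset : ∫ ω in s, (μ[g | m]) ω ∂μ ≤ ∫ _ in s, K ∂μ :=
      setIntegral_mono_ae integrable_condExp.integrableOn (integrable_const _).integrableOn hK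
    rw [setIntegral_condExp hm hg hs, setIntegral_const, smul_eq_mul] at hset
    rw [trim_measurableSet_eq hm hs, trim_measurableSet_eq hm hs,
      withDensity_apply _ (hm s hs), Measure.smul_apply, smul_eq_mul,
      ← ofReal_integral_eq_lintegral_ofReal hg.integrableOn (ae_of_all _ hg0)]
    refine (ENNReal.ofReal_le_ofReal hset).trans ?_
    rw [ENNReal.ofReal_mul measureReal_nonneg, ofReal_measureReal, mul_comm]
  calc ∫⁻ ω, f ω * ENNReal.ofReal (g ω) ∂μ = ∫⁻ ω, f ω ∂ν := by
        rw [lintegral_withDensity_eq_lintegral_mul₀ hdensity (hf.mono hm le_rfl).aemeasurable]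
        simp only [Pi.mul_apply, mul_comm]
    _ = ∫⁻ ω, f ω ∂(ν.trim hm) := (lintegral_trim hm hf).symm
    _ ≤ ∫⁻ ω, f ω ∂((ENNReal.ofReal K • μ).trim hm) := lintegral_mono' htrim le_rfl
    _ = ENNReal.ofReal K * ∫⁻ ω, f ω ∂μ := by
        rw [lintegral_trim hm hf, lintegral_smul_measure, smul_eq_mul]

theorem ae_eq_zero_of_integral_exp_le_one [IsProbabilityMeasure μ] {Y : Ω → ℝ}
    (hint : ∀ c : ℝ, Integrable (fun ω => Real.exp (c * Y ω)) μ)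
    (hle : ∀ c : ℝ, ∫ ω, Real.exp (c * Y ω) ∂μ ≤ 1) : Y =ᵐ[μ] 0 := by
  have hcosh (ω : Ω) : Real.cosh (Y ω) - 1
      = (Real.exp (1 * Y ω) + Real.exp (-1 * Y ω)) / 2 - 1 := by
    rw [Real.cosh_eq, one_mul, neg_one_mul]
  have havg : Integrable (fun ω => (Real.exp (1 * Y ω) + Real.exp (-1 * Y ω)) / 2) μ :=
    ((hint 1).add (hint (-1))).div_const 2
  have hcosh_int : Integrable (fun ω => Real.cosh (Y ω) - 1) μ := by
    simp only [hcosh]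
    exact havg.sub (integrable_const 1)
  have hnonneg (ω : Ω) : 0 ≤ Real.cosh (Y ω) - 1 := sub_nonneg.2 (Real.one_le_cosh _)
  have hzero : ∫ ω, (Real.cosh (Y ω) - 1) ∂μ = 0 := by
    refine le_antisymm ?_ (integral_nonneg hnonneg)
    simp only [hcosh]
    rw [integral_sub havg (integrable_const 1), integral_div, integral_add (hint 1) (hint (-1)),
      integral_const, probReal_univ, one_smul]
    linarith [hle 1, hle (-1)]
  rw [integral_eq_zero_iff_of_nonneg hnonneg hcosh_int] at hzero
  filter_upwards [hzero] with ω hω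
  by_contra hne
  exact (sub_pos.2 (Real.one_lt_cosh.2 hne)).ne' hω

variable {V : Type*} [Fintype V] {G : SimpleGraph V} [DecidableRel G.Adj] {ℱ : Filtration ℕ mΩ}
  {σ : ℝ} {η : ℕ → V × V → Ω → ℝ} (hη : IsSubGaussianNoise G μ ℱ σ η)
include hη

theorem IsSubGaussianNoise.const_mul (a : ℝ) :
    IsSubGaussianNoise G μ ℱ (a * σ) fun t e ω => a * η t e ω where
  measurable t e he := (hη.measurable t e he).const_mul a
  integrable t c := by simpa only [mul_assoc] using hη.integrable t fun e => c e * a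
  condExp_le t c := by
    have hle := hη.condExp_le t fun e => c e * a
    simp only [mul_pow, ← Finset.sum_mul, mul_assoc] at hle ⊢
    simpa only [mul_left_comm (a ^ 2), mul_comm (a ^ 2), mul_div_assoc, mul_assoc] using hle

variable [IsProbabilityMeasure μ]

theorem IsSubGaussianNoise.ae_eq_zero (hσ : σ = 0) (t : ℕ) {e : V × V} (he : e ∈ edges G) :
    η t e =ᵐ[μ] 0 := by
  classical
  have hsingle (c : ℝ) (ω : Ω) :
      ∑ e' ∈ edges G, Pi.single (M := fun _ => ℝ) e c e' * η t e' ω = c * η t e ω := by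
    simp [Pi.single_apply, he]
  refine ae_eq_zero_of_integral_exp_le_one (fun c => ?_) fun c => ?_
  · simpa only [hsingle] using hη.integrable t (Pi.single e c)
  · have hle := hη.condExp_le t (Pi.single e c)
    simp only [hsingle] at hle
    rw [← integral_condExp (ℱ.le t)]
    simpa [hσ] using integral_mono_ae integrable_condExp (integrable_const _) hle

theorem IsSubGaussianNoise.lintegral_mul_expTilt_const_le (t : ℕ) (c : V × V → ℝ)
    {f : Ω → ℝ≥0∞} (hf : Measurable[ℱ t] f) :
    ∫⁻ ω, f ω * expTilt (edges G) σ c (fun e => η t e ω) ∂μ ≤ ∫⁻ ω, f ω ∂μ := by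
  have hle := lintegral_mul_le_of_condExp_le (ℱ.le t) (hη.integrable t c)
    (fun _ => Real.exp_nonneg _) (hη.condExp_le t c) hf
  simp_rw [expTilt_eq_mul, ← mul_assoc]
  rw [lintegral_mul_const' _ _ ENNReal.ofReal_ne_top, mul_comm]
  refine (mul_le_mul_right hle _).trans_eq ?_
  rw [← mul_assoc, ← ENNReal.ofReal_mul (Real.exp_nonneg _), ← Real.exp_add, neg_add_cancel,
    Real.exp_zero, ENNReal.ofReal_one, one_mul]

theorem IsSubGaussianNoise.lintegral_mul_expTilt_le_of_finite_range (t : ℕ)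
    {c : Ω → V × V → ℝ} (hcm : Measurable[ℱ t] c) (hc : (Set.range c).Finite)
    {f : Ω → ℝ≥0∞} (hf : Measurable[ℱ t] f) :
    ∫⁻ ω, f ω * expTilt (edges G) σ (c ω) (fun e => η t e ω) ∂μ ≤ ∫⁻ ω, f ω ∂μ := by
  have hfiber (b : V × V → ℝ) : MeasurableSet[ℱ t] (c ⁻¹' {b}) := hcm (measurableSet_singleton b)
  have hm (b : V × V → ℝ) : MeasurableSet (c ⁻¹' {b}) := ℱ.le t _ (hfiber b)
  have hunion : ⋃ b ∈ hc.toFinset, c ⁻¹' {b} = Set.univ := by ext ω; simp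
  have hsplit (g : Ω → ℝ≥0∞) :
      ∫⁻ ω, g ω ∂μ = ∑ b ∈ hc.toFinset, ∫⁻ ω in c ⁻¹' {b}, g ω ∂μ := by
    rw [← lintegral_biUnion_finset (Set.pairwiseDisjoint_fiber c _) fun b _ => hm b, hunion,
      setLIntegral_univ]
  rw [hsplit, hsplit f]
  refine Finset.sum_le_sum fun b _ => ?_
  have hconst := hη.lintegral_mul_expTilt_const_le t b (hf.indicator (hfiber b))
  have hmul (ω : Ω) := (Set.indicator_mul_left (c ⁻¹' {b}) f
    (g := fun ω => expTilt (edges G) σ b fun e => η t e ω) (i := ω)).symm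
  simp only [hmul] at hconst
  rw [lintegral_indicator (hm b), lintegral_indicator (hm b)] at hconst
  refine le_of_eq_of_le (setLIntegral_congr_fun (hm b) fun ω hω => ?_) hconst
  simp only [show c ω = b from hω]

/- Fatou's lemma passes from simple to arbitrary predictable coefficients. -/
theorem IsSubGaussianNoise.lintegral_mul_expTilt_le (t : ℕ) {c : Ω → V × V → ℝ}
    (hc : Measurable[ℱ t] c) {f : Ω → ℝ≥0∞} (hf : Measurable[ℱ t] f) :
    ∫⁻ ω, f ω * expTilt (edges G) σ (c ω) (fun e => η t e ω) ∂μ ≤ ∫⁻ ω, f ω ∂μ := by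
  obtain ⟨C, hCm, hCfin, hClim⟩ := exists_tendsto_of_measurable hc
  let F (n : ℕ) (ω : Ω) := f ω * expTilt (edges G) σ (C n ω) fun e => η t e ω
  have hlim (ω : Ω) : Tendsto (F · ω) atTop
      (𝓝 (f ω * expTilt (edges G) σ (c ω) fun e => η t e ω)) :=
    ENNReal.Tendsto.const_mul (((continuous_expTilt _ _ _).tendsto _).comp (hClim ω))
      (Or.inl (ENNReal.ofReal_pos.2 (Real.exp_pos _)).ne')
  have hmeas (n : ℕ) : Measurable (F n) := by
    refine (hf.mono (ℱ.le t) le_rfl).mul (measurable_expTilt (fun e _ => ?_) fun e he => ?_)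
    · exact (measurable_pi_apply e).comp ((hCm n).mono (ℱ.le t) le_rfl)
    · exact (hη.measurable t e he).mono (ℱ.le _) le_rfl
  calc ∫⁻ ω, f ω * expTilt (edges G) σ (c ω) (fun e => η t e ω) ∂μ
      = ∫⁻ ω, liminf (F · ω) atTop ∂μ := lintegral_congr fun ω => (hlim ω).liminf_eq.symm
    _ ≤ liminf (fun n => ∫⁻ ω, F n ω ∂μ) atTop := lintegral_liminf_le hmeas
    _ ≤ liminf (fun _ : ℕ => ∫⁻ ω, f ω ∂μ) atTop :=
        liminf_le_liminf (.of_forall fun n => hη.lintegral_mul_expTilt_le_of_finite_range t (hCm n)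
          (hCfin n) hf)
    _ = ∫⁻ ω, f ω ∂μ := liminf_const _

end SubGaussianNoise

section Mixture

open scoped ENNReal

variable {ι κ : Type*} [Fintype ι]

/-- The density (up to normalization) against which a coefficient vector `u` enters the Gaussian
mixture: the prior `exp (-λ‖u‖² / 2)` times the exponential tilts of the first `t` rounds, where
`z (s, e)` and `n (s, e)` are the feature vector and the noise of measurement `e` in round `s`. -/
noncomputable def mixand (lam : ℝ) (E : Finset κ) (z : ℕ × κ → ι → ℝ) (n : ℕ → κ → ℝ) (t : ℕ)
    (u : ι → ℝ) : ℝ≥0∞ :=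
  ENNReal.ofReal (Real.exp (-(lam * (u ⬝ᵥ u)) / 2)) *
    ∏ s ∈ Finset.range t, expTilt E 1 (fun e => u ⬝ᵥ z (s, e)) (n s)

theorem mixand_succ (lam : ℝ) (E : Finset κ) (z : ℕ × κ → ι → ℝ) (n : ℕ → κ → ℝ) (t : ℕ)
    (u : ι → ℝ) : mixand lam E z n (t + 1) u
      = mixand lam E z n t u * expTilt E 1 (fun e => u ⬝ᵥ z (t, e)) (n t) := by
  rw [mixand, mixand, Finset.prod_range_succ, mul_assoc]

section

variable [DecidableEq ι]

theorem mixand_eq_exp (lam : ℝ) (E : Finset κ) (z : ℕ × κ → ι → ℝ) (n : ℕ → κ → ℝ) (t : ℕ)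
    (u : ι → ℝ) : mixand lam E z n t u
      = ENNReal.ofReal (Real.exp (u ⬝ᵥ (∑ k ∈ Finset.range t ×ˢ E, n k.1 k.2 • z k)
        - u ⬝ᵥ (gramMatrix lam (Finset.range t ×ˢ E) z *ᵥ u) / 2)) := by
  simp only [mixand, expTilt]
  rw [← ENNReal.ofReal_prod_of_nonneg fun _ _ => Real.exp_nonneg _, ← Real.exp_sum,
    ← ENNReal.ofReal_mul (Real.exp_nonneg _), ← Real.exp_add, dotProduct_gramMatrix_mulVec,
    dotProduct_sum, Finset.sum_product, Finset.sum_product]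
  simp only [dotProduct_smul, smul_eq_mul, Finset.sum_sub_distrib, Finset.sum_div, add_div,
    one_pow, one_mul, mul_comm]
  ring_nf

omit [DecidableEq ι] in
theorem lintegral_exp_neg_mul_dotProduct_self {lam : ℝ} (hlam : 0 < lam) :
    ∫⁻ u : ι → ℝ, ENNReal.ofReal (Real.exp (-(lam * (u ⬝ᵥ u)) / 2))
      = ENNReal.ofReal (√(lam ^ Fintype.card ι))⁻¹
        * ∫⁻ v : ι → ℝ, ENNReal.ofReal (Real.exp (-(v ⬝ᵥ v) / 2)) := by
  classical
  have hA : (lam • 1 : Matrix ι ι ℝ).PosDef := PosDef.one.smul hlam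
  have hint := lintegral_exp_neg_sq_weightedNorm hA
  simpa only [sq_weightedNorm hA.posSemidef, smul_mulVec, one_mulVec, dotProduct_smul, smul_eq_mul,
    det_smul, det_one, mul_one] using hint

theorem lintegral_mixand {lam : ℝ} (hlam : 0 < lam) (E : Finset κ) (z : ℕ × κ → ι → ℝ)
    (n : ℕ → κ → ℝ) (t : ℕ) :
    ∫⁻ u, mixand lam E z n t u
      = ENNReal.ofReal (Real.exp (weightedNorm (gramMatrix lam (Finset.range t ×ˢ E) z)⁻¹
          (∑ k ∈ Finset.range t ×ˢ E, n k.1 k.2 • z k) ^ 2 / 2)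
        * √(lam ^ Fintype.card ι / (gramMatrix lam (Finset.range t ×ˢ E) z).det))
        * ∫⁻ u : ι → ℝ, ENNReal.ofReal (Real.exp (-(lam * (u ⬝ᵥ u)) / 2)) := by
  have hA := posDef_gramMatrix hlam (Finset.range t ×ˢ E) z
  have : 0 < √(lam ^ Fintype.card ι) := Real.sqrt_pos.2 (pow_pos hlam _)
  simp_rw [mixand_eq_exp]
  rw [lintegral_exp_dotProduct_sub_half_dotProduct_mulVec hA,
    lintegral_exp_neg_mul_dotProduct_self hlam, ENNReal.ofReal_mul (Real.exp_nonneg _), mul_assoc,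
    ← mul_assoc (ENNReal.ofReal √_), ← ENNReal.ofReal_mul (Real.sqrt_nonneg _),
    Real.sqrt_div (pow_nonneg hlam.le _)]
  congr 4
  field_simp

end

theorem measurable_dotProduct {α : Type*} {_ : MeasurableSpace α} {f g : α → ι → ℝ}
    (hf : Measurable f) (hg : Measurable g) : Measurable fun a => f a ⬝ᵥ g a :=
  Finset.measurable_fun_sum _ fun i _ => (hf.eval (a := i)).mul (hg.eval (a := i))

theorem measurable_mixand {Ω : Type*} {mΩ : MeasurableSpace Ω} (lam : ℝ) {E : Finset κ}
    {z : ℕ × κ → Ω → ι → ℝ} {n : ℕ → κ → Ω → ℝ} {t : ℕ}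
    (hz : ∀ s < t, ∀ e, Measurable (z (s, e))) (hn : ∀ s < t, ∀ e ∈ E, Measurable (n s e)) :
    Measurable fun a : Ω × (ι → ℝ) => mixand lam E (z · a.1) (n · · a.1) t a.2 := by
  have hdot : Measurable fun a : Ω × (ι → ℝ) => a.2 ⬝ᵥ a.2 :=
    measurable_dotProduct measurable_snd measurable_snd
  refine (Real.measurable_exp.comp ((hdot.const_mul lam).neg.div_const 2)).ennreal_ofReal.mul
    (Finset.measurable_fun_prod _ fun s hs => measurable_expTilt (fun e _ => ?_) fun e he => ?_)
  · exact measurable_dotProduct measurable_snd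
      ((hz s (Finset.mem_range.1 hs) e).comp measurable_fst)
  · exact (hn s (Finset.mem_range.1 hs) e he).comp measurable_fst

variable {Ω : Type*} {mΩ : MeasurableSpace Ω} {μ : Measure Ω}
  {V : Type*} [Fintype V] {G : SimpleGraph V} [DecidableRel G.Adj] {ℱ : Filtration ℕ mΩ}
  {η : ℕ → V × V → Ω → ℝ} (hη : IsSubGaussianNoise G μ ℱ 1 η)
  {z : ℕ × (V × V) → Ω → ι → ℝ} {T : ℕ} (hz : ∀ t < T, ∀ e, Measurable[ℱ t] (z (t, e)))
include hη hz

theorem IsSubGaussianNoise.measurable_mixand (lam : ℝ) {t : ℕ} (ht : t ≤ T) :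
    Measurable[(ℱ t).prod MeasurableSpace.pi] fun a : Ω × (ι → ℝ) =>
      mixand lam (edges G) (z · a.1) (η · · a.1) t a.2 :=
  GraphicalBilinear.measurable_mixand (mΩ := ℱ t) lam
    (fun s hs e => (hz s (hs.trans_le ht) e).mono (ℱ.mono hs.le) le_rfl)
    fun s hs e he => (hη.measurable s e he).mono (ℱ.mono hs) le_rfl

theorem IsSubGaussianNoise.measurable_lintegral_mixand (lam : ℝ) {t : ℕ} (ht : t ≤ T) :
    Measurable[ℱ t] fun ω => ∫⁻ u, mixand lam (edges G) (z · ω) (η · · ω) t u :=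
  @Measurable.lintegral_prod_right' _ _ (ℱ t) _ _ _ _ (hη.measurable_mixand hz lam ht)

variable [IsProbabilityMeasure μ]

theorem IsSubGaussianNoise.setLIntegral_lintegral_mixand_succ_le (lam : ℝ) {t : ℕ} (ht : t < T)
    {B : Set Ω} (hB : MeasurableSet[ℱ t] B) :
    ∫⁻ ω in B, (∫⁻ u, mixand lam (edges G) (z · ω) (η · · ω) (t + 1) u) ∂μ
      ≤ ∫⁻ ω in B, (∫⁻ u, mixand lam (edges G) (z · ω) (η · · ω) t u) ∂μ := by
  have hswap {s : ℕ} (hs : s ≤ T) :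
      ∫⁻ ω in B, (∫⁻ u, mixand lam (edges G) (z · ω) (η · · ω) s u) ∂μ
        = ∫⁻ u, ∫⁻ ω in B, mixand lam (edges G) (z · ω) (η · · ω) s u ∂μ :=
    lintegral_lintegral_swap ((hη.measurable_mixand hz lam hs).mono
      (sup_le_sup_right (MeasurableSpace.comap_mono (ℱ.le s)) _) le_rfl).aemeasurable
  rw [hswap ht, hswap ht.le]
  refine lintegral_mono fun u => ?_
  have hpast : Measurable[ℱ t] fun ω => mixand lam (edges G) (z · ω) (η · · ω) t u :=
    (hη.measurable_mixand hz lam ht.le).of_uncurry_right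
  have hcoeff : Measurable[ℱ t] fun ω e => u ⬝ᵥ z (t, e) ω :=
    @measurable_pi_lambda _ _ _ (ℱ t) _ _ fun e =>
      measurable_dotProduct measurable_const (hz t ht e)
  have hle := hη.lintegral_mul_expTilt_le t hcoeff (hpast.indicator hB)
  have hsucc (ω : Ω) :
      B.indicator (fun ω => mixand lam (edges G) (z · ω) (η · · ω) t u) ω
        * expTilt (edges G) 1 (fun e => u ⬝ᵥ z (t, e) ω) (fun e => η t e ω)
      = B.indicator (fun ω => mixand lam (edges G) (z · ω) (η · · ω) (t + 1) u) ω := by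
    simp only [mixand_succ, Set.indicator_mul_left B]
  simp only [hsucc] at hle
  rwa [lintegral_indicator (ℱ.le t _ hB), lintegral_indicator (ℱ.le t _ hB)] at hle

variable [DecidableEq ι]

/- The method of mixtures: Ville's inequality is applied to the Gaussian mixture of the
exponential supermartingales `t ↦ mixand … t u`. -/
theorem IsSubGaussianNoise.measure_exists_le_mixture_le {lam δ : ℝ} (hlam : 0 < lam)
    (hδ : 0 < δ) :
    μ {ω | ∃ t ≤ T, 1 / δ ≤
      Real.exp (weightedNorm (gramMatrix lam (Finset.range t ×ˢ edges G) (z · ω))⁻¹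
          (∑ k ∈ Finset.range t ×ˢ edges G, η k.1 k.2 ω • z k ω) ^ 2 / 2)
        * √(lam ^ Fintype.card ι / (gramMatrix lam (Finset.range t ×ˢ edges G) (z · ω)).det)}
      ≤ ENNReal.ofReal δ := by
  let W (t : ℕ) (ω : Ω) : ℝ≥0∞ := ∫⁻ u, mixand lam (edges G) (z · ω) (η · · ω) t u
  let K : ℝ≥0∞ := ∫⁻ u : ι → ℝ, ENNReal.ofReal (Real.exp (-(lam * (u ⬝ᵥ u)) / 2))
  have hpow : (0 : ℝ) < (√(lam ^ Fintype.card ι))⁻¹ := by positivity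
  have hK : K = _ := lintegral_exp_neg_mul_dotProduct_self hlam
  have hK_ne_zero : K ≠ 0 := by
    rw [hK]
    exact mul_ne_zero (ENNReal.ofReal_pos.2 hpow).ne' lintegral_exp_neg_dotProduct_self_ne_zero
  have hK_ne_top : K ≠ ⊤ := by
    rw [hK]
    exact ENNReal.mul_ne_top ENNReal.ofReal_ne_top lintegral_exp_neg_dotProduct_self_ne_top
  have hville := mul_measure_exists_le_le_lintegral (μ := μ) (W := W)
    (fun t ht => hη.measurable_lintegral_mixand hz lam ht)
    (fun t ht B hB => hη.setLIntegral_lintegral_mixand_succ_le hz lam ht hB)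
    (ENNReal.ofReal (1 / δ) * K)
  have hmass : ∫⁻ ω, W 0 ω ∂μ = K := by simp [W, K, mixand]
  have hevent : μ {ω | ∃ t ≤ T, ENNReal.ofReal (1 / δ) * K ≤ W t ω} ≤ ENNReal.ofReal δ := by
    rw [hmass, mul_right_comm, one_div, ENNReal.ofReal_inv_of_pos hδ] at hville
    rw [← mul_one (ENNReal.ofReal δ),
      ← ENNReal.inv_mul_le_iff (ENNReal.ofReal_pos.2 hδ).ne' ENNReal.ofReal_ne_top,
      ← ENNReal.mul_le_mul_iff_left hK_ne_zero hK_ne_top, one_mul, one_div,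
      ENNReal.ofReal_inv_of_pos hδ]
    exact hville
  refine (measure_mono ?_).trans hevent
  rintro ω ⟨t, ht, hle⟩
  refine ⟨t, ht, ?_⟩
  have hmix : W t ω = _ * K := lintegral_mixand hlam (edges G) (z · ω) (η · · ω) t
  rw [hmix]
  gcongr

end Mixture

section SelfNormalized

variable {ι : Type*} [Fintype ι] [DecidableEq ι] (hι : 2 ≤ Fintype.card ι)
  {lam L δ : ℝ} (hlam : 0 < lam) (hδ : 0 < δ) (hδ1 : δ ≤ 1)
include hι hlam hδ hδ1

theorem weightedNorm_inv_gramMatrix_le_of_exp_mul_le {κ : Type*} {s : Finset κ} {z : κ → ι → ℝ}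
    (hz : ∀ k ∈ s, ‖WithLp.toLp 2 (z k)‖ ≤ L) {v : ι → ℝ}
    (hv : Real.exp (weightedNorm (gramMatrix lam s z)⁻¹ v ^ 2 / 2)
      * √(lam ^ Fintype.card ι / (gramMatrix lam s z).det) ≤ 1 / δ) :
    weightedNorm (gramMatrix lam s z)⁻¹ v
      ≤ √(Fintype.card ι * Real.log ((1 + s.card * L ^ 2 / lam) / δ)) := by
  have : Nonempty ι := Fintype.card_pos_iff.1 (by omega)
  set N := Fintype.card ι
  set A := gramMatrix lam s z
  let y : ℝ := s.card * L ^ 2 / lam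
  have hy : 0 ≤ y := by positivity
  have hyN : y / N ≤ y := div_le_self hy (by exact_mod_cast (by omega : 1 ≤ N))
  have hdet : 0 < A.det := (posDef_gramMatrix hlam s z).det_pos
  have hδinv : 1 ≤ 1 / δ := (one_le_div hδ).2 hδ1
  have hratio : A.det / lam ^ N ≤ (1 + y / N) ^ N := by
    rw [div_le_iff₀' (pow_pos hlam N)]
    exact det_gramMatrix_le hlam hz
  have hexp : Real.exp (weightedNorm A⁻¹ v ^ 2) * (lam ^ N / A.det) ≤ (1 / δ) ^ 2 := by
    have hsq := pow_le_pow_left₀ (by positivity) hv 2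
    rw [mul_pow, ← Real.exp_nat_mul, Real.sq_sqrt (by positivity)] at hsq
    rwa [Nat.cast_ofNat, mul_div_cancel₀ _ two_ne_zero] at hsq
  refine Real.le_sqrt_of_sq_le ?_
  rw [← Real.log_pow, Real.le_log_iff_exp_le (by positivity)]
  calc Real.exp (weightedNorm A⁻¹ v ^ 2)
      = Real.exp (weightedNorm A⁻¹ v ^ 2) * (lam ^ N / A.det) * (A.det / lam ^ N) := by
        field_simp
    _ ≤ (1 / δ) ^ 2 * (1 + y / N) ^ N := by gcongr
    _ ≤ (1 / δ) ^ N * (1 + y) ^ N := by gcongr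
    _ = ((1 + y) / δ) ^ N := by rw [← mul_pow]; ring

variable {Ω : Type*} {mΩ : MeasurableSpace Ω} {μ : Measure Ω} [IsProbabilityMeasure μ]
  {V : Type*} [Fintype V] {G : SimpleGraph V} [DecidableRel G.Adj] {ℱ : Filtration ℕ mΩ}
  {z : ℕ × (V × V) → Ω → ι → ℝ} {T : ℕ} (hz : ∀ t < T, ∀ e, Measurable[ℱ t] (z (t, e)))
  (hzL : ∀ t < T, ∀ e ω, ‖WithLp.toLp 2 (z (t, e) ω)‖ ≤ L)
include hz hzL

theorem IsSubGaussianNoise.measure_exists_lt_weightedNorm_le_of_one {η : ℕ → V × V → Ω → ℝ}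
    (hη : IsSubGaussianNoise G μ ℱ 1 η) :
    μ {ω | ∃ t ≤ T,
      √(Fintype.card ι * Real.log ((1 + t * (edges G).card * L ^ 2 / lam) / δ))
        < weightedNorm (gramMatrix lam (Finset.range t ×ˢ edges G) (z · ω))⁻¹
          (∑ k ∈ Finset.range t ×ˢ edges G, η k.1 k.2 ω • z k ω)} ≤ ENNReal.ofReal δ := by
  refine (measure_mono ?_).trans (hη.measure_exists_le_mixture_le hz hlam hδ)
  rintro ω ⟨t, ht, hlt⟩
  refine ⟨t, ht, not_lt.1 fun hmix => hlt.not_ge ?_⟩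
  have hfeature : ∀ k ∈ Finset.range t ×ˢ edges G, ‖WithLp.toLp 2 (z k ω)‖ ≤ L := fun k hk =>
    hzL _ ((Finset.mem_range.1 (Finset.mem_product.1 hk).1).trans_le ht) _ _
  simpa [Finset.card_product] using
    weightedNorm_inv_gramMatrix_le_of_exp_mul_le hι hlam hδ hδ1 hfeature hmix.le

theorem IsSubGaussianNoise.measure_exists_lt_weightedNorm_le {σ : ℝ} (hσ : 0 ≤ σ)
    {η : ℕ → V × V → Ω → ℝ} (hη : IsSubGaussianNoise G μ ℱ σ η) :
    μ {ω | ∃ t ≤ T,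
      σ * √(Fintype.card ι * Real.log ((1 + t * (edges G).card * L ^ 2 / lam) / δ))
        < weightedNorm (gramMatrix lam (Finset.range t ×ˢ edges G) (z · ω))⁻¹
          (∑ k ∈ Finset.range t ×ˢ edges G, η k.1 k.2 ω • z k ω)} ≤ ENNReal.ofReal δ := by
  obtain rfl | hσ := hσ.eq_or_lt
  · have hzero : ∀ᵐ ω ∂μ, ∀ t, ∀ e ∈ edges G, η t e ω = 0 :=
      ae_all_iff.2 fun t => (Filter.eventually_all_finset _).2 fun e he => hη.ae_eq_zero rfl t he
    refine (measure_mono_null ?_ (ae_iff.1 hzero)).trans_le zero_le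
    rintro ω ⟨t, -, hlt⟩ hω
    rw [Finset.sum_eq_zero fun k hk => by
      rw [hω _ _ (Finset.mem_product.1 hk).2, zero_smul]] at hlt
    simp [weightedNorm] at hlt
  · have hone := hη.const_mul σ⁻¹
    rw [inv_mul_cancel₀ hσ.ne'] at hone
    refine (measure_mono ?_).trans
      (hone.measure_exists_lt_weightedNorm_le_of_one hι hlam hδ hδ1 hz hzL)
    rintro ω ⟨t, ht, hlt⟩
    refine ⟨t, ht, ?_⟩
    simp only [mul_smul, ← Finset.smul_sum]
    rwa [weightedNorm_smul, abs_of_pos (inv_pos.2 hσ), lt_inv_mul_iff₀ hσ]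

end SelfNormalized

section Cuts

variable {V : Type*} [Fintype V] {G : SimpleGraph V} [DecidableRel G.Adj]

theorem swap_mem_edges {e : V × V} : e.swap ∈ edges G ↔ e ∈ edges G := by
  simp [edges, G.adj_comm]

variable [DecidableEq V]

theorem edgesFromTo_eq_card_interedges (U W : Finset V) :
    edgesFromTo G U W = (G.interedges U W).card := by
  rw [edgesFromTo]
  congr 1
  ext e
  simp [edges, SimpleGraph.mem_interedges_iff, and_comm, and_assoc]

theorem edgesFromTo_comm (U W : Finset V) : edgesFromTo G U W = edgesFromTo G W U := by
  rw [edgesFromTo_eq_card_interedges, edgesFromTo_eq_card_interedges]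
  have := G.symm
  exact Rel.card_interedges_comm U W

theorem edgesFromTo_eq_sum (U W : Finset V) :
    edgesFromTo G U W = ∑ i ∈ U, (W.filter fun j => G.Adj i j).card := by
  simp only [edgesFromTo_eq_card_interedges, SimpleGraph.interedges_def, Finset.card_filter,
    Finset.sum_product]

theorem edgesFromTo_insert_left {i : V} {U : Finset V} (hi : i ∉ U) (W : Finset V) :
    edgesFromTo G (insert i U) W = (W.filter fun j => G.Adj i j).card + edgesFromTo G U W := by
  rw [edgesFromTo_eq_sum, edgesFromTo_eq_sum, Finset.sum_insert hi]

theorem edgesFromTo_insert_right {i : V} {W : Finset V} (hi : i ∉ W) (U : Finset V) :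
    edgesFromTo G U (insert i W) = (U.filter fun j => G.Adj i j).card + edgesFromTo G U W := by
  rw [edgesFromTo_comm, edgesFromTo_insert_left hi, edgesFromTo_comm W U]

theorem edgesFromTo_insert_self {i : V} {U : Finset V} (hi : i ∉ U) :
    edgesFromTo G (insert i U) (insert i U)
      = 2 * (U.filter fun j => G.Adj i j).card + edgesFromTo G U U := by
  rw [edgesFromTo_insert_left hi, edgesFromTo_insert_right hi, Finset.filter_insert,
    if_neg G.irrefl]
  ring

variable (G) in
/-- At least half of the edges between nodes that are already placed run across the cut `c`; the
invariant of the greedy algorithm. -/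
def IsHalfCut (c : Finset V × Finset V) : Prop :=
  edgesFromTo G c.1 c.1 + edgesFromTo G c.2 c.2 ≤ edgesFromTo G c.1 c.2 + edgesFromTo G c.2 c.1

theorem IsHalfCut.approxMaxCutStep {c : Finset V × Finset V} (hc : IsHalfCut G c) {i : V}
    (h1 : i ∉ c.1) (h2 : i ∉ c.2) : IsHalfCut G (approxMaxCutStep G c i) := by
  unfold IsHalfCut at hc
  unfold IsHalfCut GraphicalBilinear.approxMaxCutStep
  split_ifs with h <;> dsimp only
  · rw [edgesFromTo_insert_self h2, edgesFromTo_insert_left h2, edgesFromTo_insert_right h2]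
    omega
  · rw [edgesFromTo_insert_self h1, edgesFromTo_insert_left h1, edgesFromTo_insert_right h1]
    omega

omit [Fintype V] in
theorem approxMaxCutStep_union (c : Finset V × Finset V) (i : V) :
    (approxMaxCutStep G c i).1 ∪ (approxMaxCutStep G c i).2 = insert i (c.1 ∪ c.2) := by
  unfold approxMaxCutStep
  split_ifs
  · exact Finset.union_insert _ _ _
  · exact Finset.insert_union _ _ _

theorem IsHalfCut.foldl_approxMaxCutStep {l : List V} (hl : l.Nodup) {c : Finset V × Finset V}
    (hc : IsHalfCut G c) (hfresh : ∀ i ∈ l, i ∉ c.1 ∪ c.2) :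
    IsHalfCut G (l.foldl (GraphicalBilinear.approxMaxCutStep G) c) := by
  induction l generalizing c with
  | nil => exact hc
  | cons i l ih =>
    obtain ⟨hil, hl⟩ := List.nodup_cons.1 hl
    obtain ⟨hi, hfresh⟩ := List.forall_mem_cons.1 hfresh
    obtain ⟨h1, h2⟩ := Finset.notMem_union.1 hi
    refine ih hl (hc.approxMaxCutStep h1 h2) fun j hj => ?_
    rw [approxMaxCutStep_union, Finset.mem_insert, not_or]
    exact ⟨ne_of_mem_of_not_mem hj hil, hfresh j hj⟩

theorem isHalfCut_approxMaxCut {l : List V} (hl : l.Nodup) : IsHalfCut G (approxMaxCut G l) := by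
  refine IsHalfCut.foldl_approxMaxCutStep hl ?_ (by simp)
  simp [IsHalfCut, edgesFromTo]

variable {V₁ V₂ : Finset V}

theorem sum_edges_ite (hcut : IsCompl V₁ V₂) {E α : Type*} [AddCommMonoid E] (f : α → α → E)
    (x x' : α) :
    ∑ e ∈ edges G, f (if e.1 ∈ V₁ then x else x') (if e.2 ∈ V₁ then x else x')
      = edgesFromTo G V₁ V₂ • f x x' + edgesFromTo G V₂ V₁ • f x' x
        + edgesFromTo G V₁ V₁ • f x x + edgesFromTo G V₂ V₂ • f x' x' := by
  have hsmul (U W : Finset V) (y : E) :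
      edgesFromTo G U W • y = ∑ e ∈ edges G, if e.1 ∈ U ∧ e.2 ∈ W then y else 0 := by
    rw [edgesFromTo, ← Finset.sum_const, Finset.sum_filter]
  simp only [hsmul, ← Finset.sum_add_distrib, ← hcut.compl_eq, Finset.mem_compl]
  refine Finset.sum_congr rfl fun e _ => ?_
  by_cases h1 : e.1 ∈ V₁ <;> by_cases h2 : e.2 ∈ V₁ <;> simp [h1, h2]

theorem card_edges_eq (hcut : IsCompl V₁ V₂) :
    (edges G).card = edgesFromTo G V₁ V₂ + edgesFromTo G V₂ V₁ + edgesFromTo G V₁ V₁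
      + edgesFromTo G V₂ V₂ := by
  simpa using sum_edges_ite (G := G) hcut (fun _ _ : Unit => (1 : ℕ)) () ()

theorem card_edges_le_of_approxMaxCut_eq (hcut : IsCompl V₁ V₂) {l : List V} (hl : l.Nodup)
    (h : approxMaxCut G l = (V₁, V₂)) :
    (edges G).card ≤ 2 * (edgesFromTo G V₁ V₂ + edgesFromTo G V₂ V₁) := by
  have hhalf : IsHalfCut G (V₁, V₂) := h ▸ isHalfCut_approxMaxCut hl
  have hcard := card_edges_eq (G := G) hcut
  simp only [IsHalfCut] at hhalf
  omega

theorem edgesFromTo_self_eq_zero_of_isBipartiteWith {s t : Set V} (h : G.IsBipartiteWith s t)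
    {U : Finset V} (hU : (U : Set V) ⊆ s) : edgesFromTo G U U = 0 := by
  rw [edgesFromTo_eq_card_interedges, Finset.card_eq_zero, Finset.eq_empty_iff_forall_notMem]
  intro e he
  obtain ⟨h1, h2, hadj⟩ := (G.mem_interedges_iff).1 he
  exact h.disjoint.notMem_of_mem_left (hU h2) (h.mem_of_mem_adj (hU h1) hadj)

end Cuts

section Rewards

variable {V : Type*} [Fintype V] {G : SimpleGraph V} [DecidableRel G.Adj] {d : ℕ}
  {X : Set (Fin d → ℝ)} {M : Matrix (Fin d) (Fin d) ℝ}

theorem globalReward_eq_sum_swap (M : Matrix (Fin d) (Fin d) ℝ) (x : V → Fin d → ℝ) :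
    globalReward G M x = ∑ e ∈ edges G, edgeReward M (x e.2) (x e.1) :=
  Finset.sum_equiv (Equiv.prodComm V V) (fun _ => swap_mem_edges.symm) fun _ _ => rfl

theorem two_mul_globalReward_le {b : ℝ}
    (hb : ∀ x ∈ X, ∀ x' ∈ X, edgeReward M x x' + edgeReward M x' x ≤ b)
    {x : V → Fin d → ℝ} (hx : ∀ i, x i ∈ X) :
    2 * globalReward G M x ≤ (edges G).card * b := by
  calc 2 * globalReward G M x
      = ∑ e ∈ edges G, (edgeReward M (x e.1) (x e.2) + edgeReward M (x e.2) (x e.1)) := by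
        rw [Finset.sum_add_distrib, ← globalReward_eq_sum_swap, two_mul, globalReward]
    _ ≤ (edges G).card * b := by
        rw [← nsmul_eq_mul]
        exact Finset.sum_le_card_nsmul _ _ _ fun e _ => hb _ (hx _) _ (hx _)

theorem edgeReward_le {L S : ℝ} {x x' : Fin d → ℝ} (hL : ‖WithLp.toLp 2 (edgeArm x x')‖ ≤ L)
    (hS : ‖WithLp.toLp 2 (vec M)‖ ≤ S) : edgeReward M x x' ≤ L * S := by
  have h := real_inner_le_norm (WithLp.toLp 2 (vec M)) (WithLp.toLp 2 (edgeArm x x'))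
  rw [EuclideanSpace.inner_toLp_toLp, star_trivial, edgeArm_dotProduct_vec, mul_comm] at h
  exact h.trans (mul_le_mul hL hS (norm_nonneg _) ((norm_nonneg _).trans hL))

theorem globalReward_le {L S : ℝ} (hL : ∀ x ∈ X, ∀ x' ∈ X, ‖WithLp.toLp 2 (edgeArm x x')‖ ≤ L)
    (hS : ‖WithLp.toLp 2 (vec M)‖ ≤ S) {x : V → Fin d → ℝ} (hx : ∀ i, x i ∈ X) :
    globalReward G M x ≤ L * S * (edges G).card := by
  rw [mul_comm, ← nsmul_eq_mul]
  exact Finset.sum_le_card_nsmul _ _ _ fun e _ => edgeReward_le (hL _ (hx _) _ (hx _)) hS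

variable [DecidableEq V] {V₁ V₂ : Finset V}

omit [Fintype V] in
theorem allocate_mem {x x' : Fin d → ℝ} (hx : x ∈ X) (hx' : x' ∈ X) (i : V) :
    allocate V₁ x x' i ∈ X := by
  unfold allocate
  split_ifs
  exacts [hx, hx']

theorem sum_edgeArm_allocate (hcut : IsCompl V₁ V₂) (x x' : Fin d → ℝ) :
    ∑ e ∈ edges G, edgeArm (allocate V₁ x x' e.1) (allocate V₁ x x' e.2)
      = cutArm G V₁ V₂ x x' := by
  simpa only [Nat.cast_smul_eq_nsmul, cutArm, allocate] using sum_edges_ite hcut edgeArm x x'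

theorem globalReward_allocate (hcut : IsCompl V₁ V₂) (M : Matrix (Fin d) (Fin d) ℝ)
    (x x' : Fin d → ℝ) :
    globalReward G M (allocate V₁ x x') = cutArm G V₁ V₂ x x' ⬝ᵥ vec M := by
  simp only [← sum_edgeArm_allocate hcut, sum_dotProduct, edgeArm_dotProduct_vec, globalReward]

theorem cutArm_dotProduct_vec (M : Matrix (Fin d) (Fin d) ℝ) (x x' : Fin d → ℝ) :
    cutArm G V₁ V₂ x x' ⬝ᵥ vec M
      = edgesFromTo G V₁ V₂ * (edgeReward M x x' + edgeReward M x' x)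
        + edgesFromTo G V₁ V₁ * edgeReward M x x + edgesFromTo G V₂ V₂ * edgeReward M x' x' := by
  simp only [cutArm, edgesFromTo_comm V₂ V₁, add_dotProduct, smul_dotProduct,
    edgeArm_dotProduct_vec, smul_eq_mul, mul_add]

end Rewards

section EllipticalPotential

theorem le_two_mul_log_one_add {x : ℝ} (h0 : 0 ≤ x) (h1 : x ≤ 1) : x ≤ 2 * Real.log (1 + x) := by
  have hlog := Real.le_log_one_add_of_nonneg h0
  have hx : x / 2 ≤ 2 * x / (x + 2) := by
    rw [div_le_div_iff₀ two_pos (by linarith)]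
    nlinarith
  linarith

theorem sum_le_sqrt_card_mul_sum_sq {ι : Type*} (s : Finset ι) (f : ι → ℝ) :
    ∑ i ∈ s, f i ≤ √(s.card * ∑ i ∈ s, f i ^ 2) :=
  Real.le_sqrt_of_sq_le sq_sum_le_card_mul_sum_sq

variable {ι : Type*} {s : Finset ι} {w : ι → ℝ} (hw : ∀ i ∈ s, 0 ≤ w i)
include hw

theorem sum_le_two_mul_log_prod_one_add (hw1 : ∀ i ∈ s, w i ≤ 1) :
    ∑ i ∈ s, w i ≤ 2 * Real.log (∏ i ∈ s, (1 + w i)) := by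
  rw [Real.log_prod fun i hi => by linarith [hw i hi], Finset.mul_sum]
  exact Finset.sum_le_sum fun i hi => le_two_mul_log_one_add (hw i hi) (hw1 i hi)

theorem prod_filter_one_add_le (p : ι → Prop) [DecidablePred p] :
    ∏ i ∈ s with p i, (1 + w i) ≤ ∏ i ∈ s, (1 + w i) := by
  refine Finset.prod_le_prod_of_subset_of_one_le (Finset.filter_subset _ _)
    (fun i hi => ?_) fun i hi _ => ?_
  · linarith [hw i (Finset.mem_filter.1 hi).1]
  · linarith [hw i hi]

theorem two_pow_card_filter_one_lt_le :
    (2 : ℝ) ^ (s.filter fun i => 1 < w i).card ≤ ∏ i ∈ s, (1 + w i) := by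
  refine le_trans ?_ (prod_filter_one_add_le hw fun i => 1 < w i)
  rw [← Finset.prod_const]
  exact Finset.prod_le_prod (fun _ _ => zero_le_two) fun i hi => by
    linarith [(Finset.mem_filter.1 hi).2]

theorem sum_le_mul_sqrt_card_mul_sum {r : ι → ℝ} {b k : ℝ} (hb : 0 ≤ b) (hk : 0 ≤ k)
    (hr : ∀ i ∈ s, r i ≤ b * √(k * w i)) :
    ∑ i ∈ s, r i ≤ b * √(s.card * (k * ∑ i ∈ s, w i)) := by
  calc ∑ i ∈ s, r i ≤ b * ∑ i ∈ s, √(k * w i) := by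
        rw [Finset.mul_sum]
        exact Finset.sum_le_sum hr
    _ ≤ b * √(s.card * ∑ i ∈ s, √(k * w i) ^ 2) := by
        gcongr
        exact sum_le_sqrt_card_mul_sum_sq s _
    _ = b * √(s.card * (k * ∑ i ∈ s, w i)) := by
        rw [Finset.sum_congr rfl fun i hi => Real.sq_sqrt (mul_nonneg hk (hw i hi)),
          ← Finset.mul_sum]

theorem sum_le_of_le_mul_sqrt {r : ι → ℝ} {b c k Q : ℝ} (hb : 0 ≤ b) (hk : 0 ≤ k)
    (hrc : ∀ i ∈ s, r i ≤ c) (hr : ∀ i ∈ s, r i ≤ b * √(k * w i))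
    (hQ : ∏ i ∈ s, (1 + w i) ≤ Q) :
    ∑ i ∈ s, r i ≤ b * √(2 * s.card * k * Real.log Q)
      + c * (s.filter fun i => 1 < w i).card := by
  rw [← Finset.sum_filter_not_add_sum_filter s fun i => 1 < w i]
  refine add_le_add ?_ ?_
  · set H := s.filter fun i => ¬ 1 < w i
    have hHs : H ⊆ s := Finset.filter_subset _ _
    have hH : ∀ i ∈ H, 0 ≤ w i := fun i hi => hw i (hHs hi)
    have hpotential : ∑ i ∈ H, w i ≤ 2 * Real.log Q := by
      refine (sum_le_two_mul_log_prod_one_add hH fun i hi =>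
        not_lt.1 (Finset.mem_filter.1 hi).2).trans ?_
      gcongr
      · exact Finset.prod_pos fun i hi => by linarith [hH i hi]
      · exact (prod_filter_one_add_le hw _).trans hQ
    calc ∑ i ∈ H, r i ≤ b * √(H.card * (k * ∑ i ∈ H, w i)) :=
          sum_le_mul_sqrt_card_mul_sum hH hb hk fun i hi => hr i (hHs hi)
      _ ≤ b * √(s.card * (k * (2 * Real.log Q))) := by
          gcongr
          exact mul_nonneg hk (Finset.sum_nonneg hH)
      _ = b * √(2 * s.card * k * Real.log Q) := by ring_nf
  · rw [mul_comm, ← nsmul_eq_mul]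
    exact Finset.sum_le_card_nsmul _ _ _ fun i hi => hrc i (Finset.mem_filter.1 hi).1

omit hw in
theorem le_ceil_mul_logb_of_two_pow_le {B n : ℕ} {y : ℝ} (hn : 2 ≤ n) (hBy : B < y)
    (hpow : (2 : ℝ) ^ B ≤ (1 + y / n) ^ n) : B ≤ ⌈n * Real.logb 2 y⌉₊ := by
  have hn' : (2 : ℝ) ≤ n := by exact_mod_cast hn
  have hy : 0 < y := (Nat.cast_nonneg B).trans_lt hBy
  obtain hy2 | hy2 := le_or_gt 2 y
  · have hbase : 1 + y / n ≤ y := by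
      linarith [div_le_div_of_nonneg_left hy.le two_pos hn']
    have hlog : (B : ℝ) ≤ n * Real.logb 2 y := by
      rw [← Real.logb_pow, Real.le_logb_iff_rpow_le one_lt_two (by positivity),
        Real.rpow_natCast]
      exact hpow.trans (by gcongr)
    exact_mod_cast hlog.trans (Nat.le_ceil _)
  · obtain rfl | hB := B.eq_zero_or_pos
    · exact Nat.zero_le _
    · have hB1 : B < 2 := by exact_mod_cast hBy.trans hy2
      have hy1 : 1 < y := lt_of_le_of_lt (by exact_mod_cast hB) hBy
      have hlog : 0 < n * Real.logb 2 y :=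
        mul_pos (by linarith) (Real.logb_pos one_lt_two hy1)
      exact (Nat.le_of_lt_succ hB1).trans (Nat.ceil_pos.2 hlog)

theorem card_filter_one_lt_le_ceil {n : ℕ} (hn : 2 ≤ n) {k : ℝ} (hwk : ∀ i ∈ s, w i ≤ k)
    (hprod : ∏ i ∈ s, (1 + w i) ≤ (1 + s.card * k / n) ^ n) :
    (s.filter fun i => 1 < w i).card ≤ ⌈n * Real.logb 2 (s.card * k)⌉₊ := by
  obtain hB | ⟨i, hi⟩ := (s.filter fun i => 1 < w i).eq_empty_or_nonempty
  · simp [hB]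
  obtain ⟨his, hwi⟩ := Finset.mem_filter.1 hi
  have hk : 1 < k := hwi.trans_le (hwk i his)
  have hs : (0 : ℝ) < s.card := by exact_mod_cast Finset.card_pos.2 ⟨i, his⟩
  refine le_ceil_mul_logb_of_two_pow_le hn ?_ ((two_pow_card_filter_one_lt_le hw).trans hprod)
  calc ((s.filter fun i => 1 < w i).card : ℝ) ≤ s.card := by gcongr; exact Finset.filter_subset _ _
    _ < s.card * k := lt_mul_of_one_lt_right hs hk

end EllipticalPotential

section BatchWidth

variable {ι κ : Type*} [Fintype ι] [DecidableEq ι]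

/-- The squared width of the batch of features played in round `t`: the sum of their squared norms
with respect to the inverse of the Gram matrix of the preceding rounds. -/
noncomputable def batchWidth (lam : ℝ) (E : Finset κ) (z : ℕ × κ → ι → ℝ) (t : ℕ) : ℝ :=
  ∑ e ∈ E, weightedNorm (gramMatrix lam (Finset.range t ×ˢ E) z)⁻¹ (z (t, e)) ^ 2

theorem batchWidth_nonneg (lam : ℝ) (E : Finset κ) (z : ℕ × κ → ι → ℝ) (t : ℕ) :
    0 ≤ batchWidth lam E z t :=
  Finset.sum_nonneg fun _ _ => sq_nonneg _

variable {lam L : ℝ} (hlam : 0 < lam) {E : Finset κ} {z : ℕ × κ → ι → ℝ}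
include hlam

theorem batchWidth_le {t : ℕ} (hz : ∀ e ∈ E, ‖WithLp.toLp 2 (z (t, e))‖ ≤ L) :
    batchWidth lam E z t ≤ E.card * (L ^ 2 / lam) := by
  rw [← nsmul_eq_mul]
  refine Finset.sum_le_card_nsmul _ _ _ fun e he => ?_
  rw [le_div_iff₀' hlam]
  refine (mul_sq_weightedNorm_inv_gramMatrix_le hlam _ z _).trans ?_
  gcongr
  exact hz e he

theorem sum_dotProduct_le_mul_sqrt_batchWidth (t : ℕ) (v : ι → ℝ) :
    (∑ e ∈ E, z (t, e)) ⬝ᵥ v ≤ weightedNorm (gramMatrix lam (Finset.range t ×ˢ E) z) v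
      * √(E.card * batchWidth lam E z t) := by
  set A := gramMatrix lam (Finset.range t ×ˢ E) z
  have hA : A.PosDef := posDef_gramMatrix hlam _ z
  calc (∑ e ∈ E, z (t, e)) ⬝ᵥ v
      ≤ ∑ e ∈ E, weightedNorm A⁻¹ (z (t, e)) * weightedNorm A v := by
        rw [sum_dotProduct]
        exact Finset.sum_le_sum fun e _ =>
          (le_abs_self _).trans (abs_dotProduct_le_weightedNorm_mul hA _ _)
    _ = weightedNorm A v * ∑ e ∈ E, weightedNorm A⁻¹ (z (t, e)) := by
        rw [← Finset.sum_mul, mul_comm]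
    _ ≤ weightedNorm A v * √(E.card * batchWidth lam E z t) :=
        mul_le_mul_of_nonneg_left (sum_le_sqrt_card_mul_sum_sq E _) (Real.sqrt_nonneg _)

variable {T : ℕ} (hz : ∀ t < T, ∀ e ∈ E, ‖WithLp.toLp 2 (z (t, e))‖ ≤ L)
include hz

theorem prod_one_add_batchWidth_le [Nonempty ι] :
    ∏ t ∈ Finset.range T, (1 + batchWidth lam E z t)
      ≤ (1 + T * (E.card * (L ^ 2 / lam)) / Fintype.card ι) ^ Fintype.card ι := by
  refine le_of_mul_le_mul_left ?_ (pow_pos hlam (Fintype.card ι))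
  refine (pow_mul_prod_one_add_le_det_gramMatrix hlam T E z).trans ?_
  have hdet := det_gramMatrix_le (L := L) hlam (s := Finset.range T ×ˢ E) (z := z)
    fun k hk => hz k.1 (Finset.mem_range.1 (Finset.mem_product.1 hk).1) k.2
      (Finset.mem_product.1 hk).2
  rwa [Finset.card_product, Finset.card_range, Nat.cast_mul, mul_assoc, mul_div_assoc,
    mul_div_assoc (E.card : ℝ)] at hdet

theorem sum_le_of_le_mul_sqrt_batchWidth (hι : 2 ≤ Fintype.card ι) {r : ℕ → ℝ} {ρ c : ℝ}
    (hρ : 0 ≤ ρ) (hc : 0 ≤ c) (hrc : ∀ t < T, r t ≤ c)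
    (hr : ∀ t < T, r t ≤ ρ * √(E.card * batchWidth lam E z t)) :
    ∑ t ∈ Finset.range T, r t
      ≤ ρ * √(2 * T * E.card * (Fintype.card ι
          * Real.log (1 + T * E.card * L ^ 2 / lam / Fintype.card ι)))
        + c * ⌈Fintype.card ι * Real.logb 2 (T * E.card * L ^ 2 / lam)⌉₊ := by
  have : Nonempty ι := Fintype.card_pos_iff.1 (by omega)
  have hy : T * E.card * L ^ 2 / lam = T * (E.card * (L ^ 2 / lam)) := by ring
  have hw : ∀ t ∈ Finset.range T, 0 ≤ batchWidth lam E z t := fun t _ =>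
    batchWidth_nonneg lam E z t
  have hprod := prod_one_add_batchWidth_le hlam hz
  rw [hy, ← Real.log_pow]
  refine (sum_le_of_le_mul_sqrt hw hρ (Nat.cast_nonneg E.card)
    (fun t ht => hrc t (Finset.mem_range.1 ht)) (fun t ht => hr t (Finset.mem_range.1 ht))
    hprod).trans ?_
  have hcount := card_filter_one_lt_le_ceil hw hι (k := E.card * (L ^ 2 / lam))
    (fun t ht => batchWidth_le hlam (hz t (Finset.mem_range.1 ht)))
    (by rwa [Finset.card_range])
  rw [Finset.card_range] at hcount ⊢
  gcongr

end BatchWidth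

section Confidence

variable {V : Type*} {d : ℕ}

/-- The edge-arms of all rounds, as one family of features indexed by the round and the edge. -/
def edgeFeature (a : ℕ → V → Fin d → ℝ) (k : ℕ × (V × V)) : Fin d × Fin d → ℝ :=
  edgeArm (a k.1 k.2.1) (a k.1 k.2.2)

theorem measurable_edgeArm {Ω : Type*} {_ : MeasurableSpace Ω} {x x' : Ω → Fin d → ℝ}
    (hx : Measurable x) (hx' : Measurable x') : Measurable fun ω => edgeArm (x ω) (x' ω) := by
  refine measurable_pi_lambda _ fun i => ?_
  simp only [edgeArm, vec, vecMulVec, of_apply]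
  fun_prop

theorem confidenceRadius_nonneg {m : ℕ} {σ lam L S δ : ℝ} (hσ : 0 ≤ σ) (hS : 0 ≤ S) (t : ℕ) :
    0 ≤ confidenceRadius d m σ lam L S δ t := by
  unfold confidenceRadius
  positivity

theorem monotone_confidenceRadius {m : ℕ} {σ lam L S δ : ℝ} (hσ : 0 ≤ σ) (hlam : 0 < lam)
    (hδ : 0 < δ) : Monotone (confidenceRadius d m σ lam L S δ) := by
  intro s t hst
  unfold confidenceRadius
  gcongr

variable [Fintype V] {G : SimpleGraph V} [DecidableRel G.Adj] {σ lam L S δ : ℝ}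

theorem designMatrix_eq_gramMatrix (lam : ℝ) (a : ℕ → V → Fin d → ℝ) (t : ℕ) :
    designMatrix G lam a t = gramMatrix lam (Finset.range t ×ˢ edges G) (edgeFeature a) := by
  rw [gramMatrix, Finset.sum_product]
  rfl

theorem estimator_observedReward {Ω : Type*} (M : Matrix (Fin d) (Fin d) ℝ)
    (η : ℕ → V × V → Ω → ℝ) (a : ℕ → V → Fin d → ℝ) (ω : Ω) (t : ℕ) :
    estimator G lam a (observedReward M η a ω) t
      = (gramMatrix lam (Finset.range t ×ˢ edges G) (edgeFeature a))⁻¹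
        *ᵥ ∑ k ∈ Finset.range t ×ˢ edges G,
          (edgeFeature a k ⬝ᵥ vec M + η k.1 k.2 ω) • edgeFeature a k := by
  simp only [estimator, designMatrix_eq_gramMatrix, observedReward, Finset.sum_product,
    edgeFeature, edgeArm_dotProduct_vec]

theorem weightedNorm_sub_le_of_mem_confidenceSet (hlam : 0 < lam) {a : ℕ → V → Fin d → ℝ}
    {y : ℕ → V × V → ℝ} {t : ℕ} {θ θ' : Fin d × Fin d → ℝ}
    (hθ : θ ∈ confidenceSet G σ lam L S δ a y t) (hθ' : θ' ∈ confidenceSet G σ lam L S δ a y t) :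
    weightedNorm (designMatrix G lam a t) (θ - θ')
      ≤ 2 * confidenceRadius d (edges G).card σ lam L S δ t := by
  have hA : (designMatrix G lam a t).PosDef := by
    rw [designMatrix_eq_gramMatrix]
    exact posDef_gramMatrix hlam _ _
  rw [← sub_sub_sub_cancel_right θ θ' (estimator G lam a y t), sub_eq_add_neg, two_mul]
  refine (weightedNorm_add_le hA _ _).trans (add_le_add hθ ?_)
  rw [weightedNorm_neg]
  exact hθ'

theorem vec_mem_confidenceSet {Ω : Type*} {M : Matrix (Fin d) (Fin d) ℝ} (hlam : 0 < lam)
    (hS : ‖WithLp.toLp 2 (vec M)‖ ≤ S) {η : ℕ → V × V → Ω → ℝ} {a : ℕ → V → Fin d → ℝ} {ω : Ω}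
    {t : ℕ}
    (hnoise : weightedNorm (gramMatrix lam (Finset.range t ×ˢ edges G) (edgeFeature a))⁻¹
        (∑ k ∈ Finset.range t ×ˢ edges G, η k.1 k.2 ω • edgeFeature a k)
      ≤ σ * √(d ^ 2 * Real.log ((1 + t * (edges G).card * L ^ 2 / lam) / δ))) :
    vec M ∈ confidenceSet G σ lam L S δ a (observedReward M η a ω) t := by
  rw [confidenceSet, Set.mem_ofPred_eq, estimator_observedReward, designMatrix_eq_gramMatrix]
  have hridge := weightedNorm_sub_ridge_le hlam (Finset.range t ×ˢ edges G) (edgeFeature a)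
    (fun k => η k.1 k.2 ω) (vec M)
  refine hridge.trans (add_le_add hnoise ?_)
  gcongr

theorem IsSubGaussianNoise.measure_exists_notMem_confidenceSet_le {Ω : Type*}
    {mΩ : MeasurableSpace Ω} {μ : Measure Ω} [IsProbabilityMeasure μ] {ℱ : Filtration ℕ mΩ}
    {η : ℕ → V × V → Ω → ℝ} (hη : IsSubGaussianNoise G μ ℱ σ η) (hσ : 0 ≤ σ) (hd : 2 ≤ d)
    {M : Matrix (Fin d) (Fin d) ℝ} (hlam : 0 < lam) (hδ : 0 < δ) (hδ1 : δ ≤ 1)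
    (hS : ‖WithLp.toLp 2 (vec M)‖ ≤ S) {T : ℕ} {a : Ω → ℕ → V → Fin d → ℝ}
    (ha : ∀ t < T, ∀ i, Measurable[ℱ t] fun ω => a ω t i)
    (hL : ∀ t < T, ∀ ω i j, ‖WithLp.toLp 2 (edgeArm (a ω t i) (a ω t j))‖ ≤ L) :
    μ {ω | ∃ t ≤ T, vec M ∉ confidenceSet G σ lam L S δ (a ω) (observedReward M η (a ω) ω) t}
      ≤ ENNReal.ofReal δ := by
  have hι : 2 ≤ Fintype.card (Fin d × Fin d) := by
    rw [Fintype.card_prod, Fintype.card_fin]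
    nlinarith
  have hmeas : ∀ t < T, ∀ e : V × V, Measurable[ℱ t] fun ω => edgeFeature (a ω) (t, e) :=
    fun t ht e => measurable_edgeArm (ha t ht e.1) (ha t ht e.2)
  have hnorm : ∀ t < T, ∀ (e : V × V) ω, ‖WithLp.toLp 2 (edgeFeature (a ω) (t, e))‖ ≤ L :=
    fun t ht e ω => hL t ht ω e.1 e.2
  have hbound := IsSubGaussianNoise.measure_exists_lt_weightedNorm_le hι hlam hδ hδ1
    (z := fun k ω => edgeFeature (a ω) k) hmeas hnorm hσ hη
  refine (measure_mono ?_).trans hbound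
  rintro ω ⟨t, ht, hM⟩
  refine ⟨t, ht, not_le.1 fun hnoise => hM (vec_mem_confidenceSet hlam hS ?_)⟩
  rwa [Fintype.card_prod, Fintype.card_fin, Nat.cast_mul, ← sq] at hnoise

end Confidence

section Regret

theorem le_regretBound {d m T : ℕ} {σ lam L S δ : ℝ} (hσ : 0 ≤ σ) (hlam : 0 < lam) (hL : 0 ≤ L)
    (hS : 0 ≤ S) (hδ : 0 < δ) (hδ1 : δ ≤ 1) :
    2 * confidenceRadius d m σ lam L S δ T
        * √(2 * T * m * (d ^ 2 * Real.log (1 + T * m * L ^ 2 / lam / d ^ 2)))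
      + L * S * m * ⌈d ^ 2 * Real.logb 2 (T * m * L ^ 2 / lam)⌉₊
    ≤ regretBound d m T σ lam L S δ := by
  set y := T * m * L ^ 2 / lam with hy
  have hy0 : 0 ≤ y := by positivity
  have hwidth : 2 * √(2 * T * m * (d ^ 2 * Real.log (1 + y / d ^ 2)))
      ≤ √(32 * T * m * d ^ 2 * max 2 ((L * S) ^ 2) * Real.log (1 + y / d ^ 2)) := by
    have hlog : 0 ≤ Real.log (1 + y / d ^ 2) :=
      Real.log_nonneg (le_add_of_nonneg_right (by positivity))
    refine Real.le_sqrt_of_sq_le ?_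
    rw [mul_pow, Real.sq_sqrt (by positivity)]
    have hZ : 0 ≤ T * m * d ^ 2 * Real.log (1 + y / d ^ 2) := by positivity
    nlinarith [mul_le_mul_of_nonneg_left (le_max_left 2 ((L * S) ^ 2)) hZ]
  have hcount : Real.logb 2 y ≤ Real.logb 2 (y / δ) := by
    obtain hy | hy := hy0.eq_or_lt
    · simp [← hy]
    · exact Real.logb_le_logb_of_le one_lt_two hy (le_div_self hy.le hδ hδ1)
  rw [mul_right_comm, regretBound, ← hy]
  refine add_le_add (mul_le_mul_of_nonneg_right hwidth (confidenceRadius_nonneg hσ hS T)) ?_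
  gcongr

variable {V : Type*} [Fintype V] [DecidableEq V] {G : SimpleGraph V} [DecidableRel G.Adj] {d : ℕ}
  {M : Matrix (Fin d) (Fin d) ℝ} {V₁ V₂ : Finset V} {σ lam L S δ : ℝ} {T : ℕ}

theorem sub_globalReward_le_mul_sqrt_batchWidth (hcut : IsCompl V₁ V₂) (hlam : 0 < lam)
    {a : ℕ → V → Fin d → ℝ} {t : ℕ} {x x' : Fin d → ℝ} (ha : a t = allocate V₁ x x')
    {θ : Fin d × Fin d → ℝ} {c ρ : ℝ} (hc : c ≤ cutArm G V₁ V₂ x x' ⬝ᵥ θ)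
    (hθ : weightedNorm (designMatrix G lam a t) (θ - vec M) ≤ ρ) :
    c - globalReward G M (a t)
      ≤ ρ * √((edges G).card * batchWidth lam (edges G) (edgeFeature a) t) := by
  have hsum : ∑ e ∈ edges G, edgeFeature a (t, e) = cutArm G V₁ V₂ x x' := by
    simp only [edgeFeature, ha, sum_edgeArm_allocate hcut]
  calc c - globalReward G M (a t) ≤ cutArm G V₁ V₂ x x' ⬝ᵥ (θ - vec M) := by
        rw [ha, globalReward_allocate hcut, dotProduct_sub]
        gcongr
    _ ≤ weightedNorm (designMatrix G lam a t) (θ - vec M)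
          * √((edges G).card * batchWidth lam (edges G) (edgeFeature a) t) := by
        rw [← hsum, designMatrix_eq_gramMatrix]
        exact sum_dotProduct_le_mul_sqrt_batchWidth hlam t _
    _ ≤ ρ * √((edges G).card * batchWidth lam (edges G) (edgeFeature a) t) := by gcongr

theorem sum_sub_globalReward_le_regretBound (hcut : IsCompl V₁ V₂) (hd : 2 ≤ d) (hσ : 0 ≤ σ)
    (hlam : 0 < lam) (hL : 0 ≤ L) (hS : 0 ≤ S) (hδ : 0 < δ) (hδ1 : δ ≤ 1)
    {x x' : ℕ → Fin d → ℝ} {a : ℕ → V → Fin d → ℝ}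
    (ha : ∀ t, a t = allocate V₁ (x t) (x' t))
    (hnorm : ∀ t < T, ∀ i j, ‖WithLp.toLp 2 (edgeArm (a t i) (a t j))‖ ≤ L)
    (hpos : ∀ t < T, 0 ≤ globalReward G M (a t)) {c : ℝ} (hc : c ≤ L * S * (edges G).card)
    {y : ℕ → V × V → ℝ} (hM : ∀ t < T, vec M ∈ confidenceSet G σ lam L S δ a y t)
    (hopt : ∀ t < T, ∃ θ ∈ confidenceSet G σ lam L S δ a y t,
      c ≤ cutArm G V₁ V₂ (x t) (x' t) ⬝ᵥ θ) :
    ∑ t ∈ Finset.range T, (c - globalReward G M (a t))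
      ≤ regretBound d (edges G).card T σ lam L S δ := by
  set R := confidenceRadius d (edges G).card σ lam L S δ
  have hround : ∀ t < T, c - globalReward G M (a t)
      ≤ 2 * R T * √((edges G).card * batchWidth lam (edges G) (edgeFeature a) t) := by
    intro t ht
    obtain ⟨θ, hθ, hcθ⟩ := hopt t ht
    refine sub_globalReward_le_mul_sqrt_batchWidth hcut hlam (ha t) hcθ
      ((weightedNorm_sub_le_of_mem_confidenceSet hlam hθ (hM t ht)).trans ?_)
    exact mul_le_mul_of_nonneg_left (monotone_confidenceRadius hσ hlam hδ ht.le) zero_le_two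
  have hR : 0 ≤ 2 * R T := mul_nonneg zero_le_two (confidenceRadius_nonneg hσ hS T)
  have hι : Fintype.card (Fin d × Fin d) = d ^ 2 := by
    rw [Fintype.card_prod, Fintype.card_fin, sq]
  have hι2 : 2 ≤ Fintype.card (Fin d × Fin d) := by
    rw [hι]
    nlinarith
  have hsum := sum_le_of_le_mul_sqrt_batchWidth (E := edges G) (z := edgeFeature a) hlam
    (fun t ht e _ => hnorm t ht e.1 e.2) hι2 hR (c := L * S * (edges G).card) (by positivity)
    (fun t ht => by linarith [hpos t ht]) hround
  rw [hι, Nat.cast_pow] at hsum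
  exact hsum.trans (le_regretBound hσ hlam hL hS hδ hδ1)

variable (G) in
/-- A run of the optimistic algorithm as in `IsImprovedOFULRun`, for an arm set `X` that need not
be finite. -/
structure IsOptimisticRun {Ω : Type*} {mΩ : MeasurableSpace Ω} (ℱ : Filtration ℕ mΩ)
    (X : Set (Fin d → ℝ)) (M : Matrix (Fin d) (Fin d) ℝ) (η : ℕ → V × V → Ω → ℝ)
    (V₁ V₂ : Finset V) (σ lam L S δ : ℝ) (T : ℕ) (x x' : ℕ → Ω → Fin d → ℝ) : Prop where
  measurable_fst : ∀ t < T, Measurable[ℱ t] (x t)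
  measurable_snd : ∀ t < T, Measurable[ℱ t] (x' t)
  mem_fst : ∀ t < T, ∀ ω, x t ω ∈ X
  mem_snd : ∀ t < T, ∀ ω, x' t ω ∈ X
  optimistic : ∀ t < T, ∀ ω,
    let a : ℕ → V → Fin d → ℝ := fun s => allocate V₁ (x s ω) (x' s ω)
    let C : Set (Fin d × Fin d → ℝ) :=
      confidenceSet G σ lam L S δ a (observedReward M η a ω) t
    ∃ θ ∈ C, ∀ y ∈ X, ∀ y' ∈ X, ∀ θ' ∈ C,
      cutArm G V₁ V₂ y y' ⬝ᵥ θ' ≤ cutArm G V₁ V₂ (x t ω) (x' t ω) ⬝ᵥ θ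

variable {Ω : Type*} {mΩ : MeasurableSpace Ω} {ℱ : Filtration ℕ mΩ} {η : ℕ → V × V → Ω → ℝ}
  {x x' : ℕ → Ω → Fin d → ℝ}

theorem IsImprovedOFULRun.isOptimisticRun {X : Finset (Fin d → ℝ)}
    (hrun : IsImprovedOFULRun G ℱ X M η V₁ V₂ σ lam L S δ T x x') :
    IsOptimisticRun G ℱ X M η V₁ V₂ σ lam L S δ T x x' :=
  ⟨hrun.measurable_fst, hrun.measurable_snd, hrun.mem_fst, hrun.mem_snd, hrun.optimistic⟩

variable {X : Set (Fin d → ℝ)}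

omit [Fintype V] in
theorem measurable_allocate {mΩ : MeasurableSpace Ω} {x x' : Ω → Fin d → ℝ} (hx : Measurable x)
    (hx' : Measurable x') (i : V) : Measurable fun ω => allocate V₁ (x ω) (x' ω) i := by
  unfold allocate
  split_ifs
  exacts [hx, hx']

theorem IsOptimisticRun.one_sub_le_measureReal {μ : Measure Ω} [IsProbabilityMeasure μ]
    (hrun : IsOptimisticRun G ℱ X M η V₁ V₂ σ lam L S δ T x x')
    (hη : IsSubGaussianNoise G μ ℱ σ η) (hcut : IsCompl V₁ V₂) (hd : 2 ≤ d) (hσ : 0 ≤ σ)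
    (hlam : 0 < lam) (hδ : 0 < δ) (hδ1 : δ ≤ 1)
    (hL : ∀ x ∈ X, ∀ x' ∈ X, ‖WithLp.toLp 2 (edgeArm x x')‖ ≤ L)
    (hS : ‖WithLp.toLp 2 (vec M)‖ ≤ S) (hpos : ∀ x ∈ X, ∀ x' ∈ X, 0 ≤ edgeReward M x x')
    {y y' : Fin d → ℝ} (hy : y ∈ X) (hy' : y' ∈ X) {c : ℝ}
    (hcy : c ≤ cutArm G V₁ V₂ y y' ⬝ᵥ vec M) (hc : c ≤ L * S * (edges G).card) :
    1 - δ ≤ μ.real {ω | ∑ t ∈ Finset.range T,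
      (c - globalReward G M (allocate V₁ (x t ω) (x' t ω)))
        ≤ regretBound d (edges G).card T σ lam L S δ} := by
  set a : Ω → ℕ → V → Fin d → ℝ := fun ω t => allocate V₁ (x t ω) (x' t ω)
  have haX : ∀ t < T, ∀ ω i, a ω t i ∈ X := fun t ht ω =>
    allocate_mem (hrun.mem_fst t ht ω) (hrun.mem_snd t ht ω)
  have hnorm : ∀ t < T, ∀ ω i j, ‖WithLp.toLp 2 (edgeArm (a ω t i) (a ω t j))‖ ≤ L :=
    fun t ht ω i j => hL _ (haX t ht ω i) _ (haX t ht ω j)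
  set bad : Set Ω := {ω | ∃ t ≤ T,
    vec M ∉ confidenceSet G σ lam L S δ (a ω) (observedReward M η (a ω) ω) t}
  have hbad : μ.real bad ≤ δ := by
    refine ENNReal.toReal_le_of_le_ofReal hδ.le ?_
    exact hη.measure_exists_notMem_confidenceSet_le hσ hd hlam hδ hδ1 hS
      (fun t ht => measurable_allocate (hrun.measurable_fst t ht) (hrun.measurable_snd t ht))
      hnorm
  have hgood : badᶜ ⊆ {ω | ∑ t ∈ Finset.range T, (c - globalReward G M (a ω t))
      ≤ regretBound d (edges G).card T σ lam L S δ} := by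
    intro ω hω
    have hM : ∀ t < T,
        vec M ∈ confidenceSet G σ lam L S δ (a ω) (observedReward M η (a ω) ω) t :=
      fun t ht => not_not.1 fun h => hω ⟨t, ht.le, h⟩
    refine sum_sub_globalReward_le_regretBound hcut hd hσ hlam
      ((norm_nonneg _).trans (hL y hy y hy)) ((norm_nonneg _).trans hS) hδ hδ1 (fun _ => rfl)
      (fun t ht => hnorm t ht ω)
      (fun t ht => Finset.sum_nonneg fun e _ => hpos _ (haX t ht ω _) _ (haX t ht ω _)) hc hM
      fun t ht => ?_
    obtain ⟨θ, hθ, hmax⟩ := hrun.optimistic t ht ω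
    exact ⟨θ, hθ, hcy.trans (hmax y hy y' hy' _ (hM t ht))⟩
  have hcover := measureReal_union_le (μ := μ) bad badᶜ
  rw [Set.union_compl_self, probReal_univ] at hcover
  linarith [measureReal_mono (μ := μ) hgood]

end Regret

section ApproximationRatio

variable {opt γ : ℝ}

section Ratio

variable {β : Type*} {X : Set β} {f : β → ℝ} {m : ℕ}

theorem mem_Icc_of_isLeast_image_div (hm : 0 < m) (hopt : 0 < opt) (hf : ∀ x ∈ X, 0 ≤ f x)
    (hfm : ∀ x ∈ X, m * f x ≤ opt) (hγ : IsLeast ((fun x => f x / (1 / m * opt)) '' X) γ) :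
    γ ∈ Set.Icc 0 1 := by
  obtain ⟨x, hx, rfl⟩ := hγ.1
  refine ⟨div_nonneg (hf x hx) (by positivity), div_le_one_of_le₀ ?_ (by positivity)⟩
  rw [one_div, le_inv_mul_iff₀ (by positivity)]
  exact hfm x hx

theorem mul_le_of_isLeast_image_div (hm : 0 < m) (hopt : 0 < opt)
    (hγ : IsLeast ((fun x => f x / (1 / m * opt)) '' X) γ) {x : β} (hx : x ∈ X) :
    γ * opt ≤ m * f x := by
  have hle := hγ.2 (Set.mem_image_of_mem _ hx)
  rwa [le_div_iff₀ (by positivity), one_div, mul_left_comm, inv_mul_le_iff₀ (by positivity)]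
    at hle

theorem sub_div_mem_Icc {v w b : ℝ} (hopt : 0 < opt) (hbv : b * opt ≤ v) (hvw : v ≤ w)
    (hw : w ≤ opt) : (w - v) / opt ∈ Set.Icc 0 (1 - b) := by
  refine ⟨div_nonneg (sub_nonneg.2 hvw) hopt.le, (div_le_iff₀ hopt).2 ?_⟩
  linarith

end Ratio

variable {V : Type*} [Fintype V] {G : SimpleGraph V} [DecidableRel G.Adj] {d : ℕ}
  {M : Matrix (Fin d) (Fin d) ℝ}

theorem globalReward_const (M : Matrix (Fin d) (Fin d) ℝ) (x : Fin d → ℝ) :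
    globalReward G M (fun _ => x) = (edges G).card * edgeReward M x x := by
  rw [globalReward, Finset.sum_const, nsmul_eq_mul]

variable [DecidableEq V] {V₁ V₂ : Finset V}

/-- The fraction of the edges that do not cross the cut, `(m₁ + m₂) / m` (and `0` if there are no
edges). -/
noncomputable def uncutFraction (G : SimpleGraph V) [DecidableRel G.Adj] (V₁ V₂ : Finset V) : ℝ :=
  ((edgesFromTo G V₁ V₁ : ℝ) + edgesFromTo G V₂ V₂) / (edges G).card

theorem uncutFraction_nonneg : 0 ≤ uncutFraction G V₁ V₂ := by
  unfold uncutFraction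
  positivity

theorem uncutFraction_le_half (hcut : IsCompl V₁ V₂)
    (hhalf : (edges G).card ≤ 2 * (edgesFromTo G V₁ V₂ + edgesFromTo G V₂ V₁)) :
    uncutFraction G V₁ V₂ ≤ 1 / 2 := by
  have hcard := card_edges_eq (G := G) hcut
  have huncut : 2 * (edgesFromTo G V₁ V₁ + edgesFromTo G V₂ V₂) ≤ (edges G).card := by omega
  refine div_le_of_le_mul₀ (Nat.cast_nonneg _) one_half_pos.le ?_
  have : (2 : ℝ) * (edgesFromTo G V₁ V₁ + edgesFromTo G V₂ V₂) ≤ (edges G).card := by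
    exact_mod_cast huncut
  linarith

theorem uncutFraction_eq_zero (h : G.IsBipartiteWith (V₁ : Set V) (V₂ : Set V)) :
    uncutFraction G V₁ V₂ = 0 := by
  simp [uncutFraction, edgesFromTo_self_eq_zero_of_isBipartiteWith h subset_rfl,
    edgesFromTo_self_eq_zero_of_isBipartiteWith h.symm subset_rfl]

/-- A cut edge earns at least the average edge reward of the optimum, an uncut edge at least the
fraction `γ` of it. -/
theorem mul_le_cutArm_dotProduct_vec (hcut : IsCompl V₁ V₂) (hm : 0 < (edges G).card)
    {x x' : Fin d → ℝ}
    (hpair : 2 * opt ≤ (edges G).card * (edgeReward M x x' + edgeReward M x' x))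
    (hx : γ * opt ≤ (edges G).card * edgeReward M x x)
    (hx' : γ * opt ≤ (edges G).card * edgeReward M x' x') :
    (1 - uncutFraction G V₁ V₂ * (1 - γ)) * opt ≤ cutArm G V₁ V₂ x x' ⬝ᵥ vec M := by
  have hm' : (0 : ℝ) < (edges G).card := by exact_mod_cast hm
  have hcard : ((edges G).card : ℝ) = 2 * edgesFromTo G V₁ V₂ + edgesFromTo G V₁ V₁
      + edgesFromTo G V₂ V₂ := by
    rw [card_edges_eq hcut, edgesFromTo_comm V₂ V₁]
    push_cast
    ring
  refine le_of_mul_le_mul_left ?_ hm'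
  calc (edges G).card * ((1 - uncutFraction G V₁ V₂ * (1 - γ)) * opt)
      = edgesFromTo G V₁ V₂ * (2 * opt) + edgesFromTo G V₁ V₁ * (γ * opt)
          + edgesFromTo G V₂ V₂ * (γ * opt) := by
        rw [uncutFraction]
        field_simp
        rw [hcard]
        ring
    _ ≤ edgesFromTo G V₁ V₂ * ((edges G).card * (edgeReward M x x' + edgeReward M x' x))
          + edgesFromTo G V₁ V₁ * ((edges G).card * edgeReward M x x)
          + edgesFromTo G V₂ V₂ * ((edges G).card * edgeReward M x' x') := by gcongr
    _ = (edges G).card * cutArm G V₁ V₂ x x' ⬝ᵥ vec M := by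
        rw [cutArm_dotProduct_vec]
        ring

end ApproximationRatio

end GraphicalBilinear

open GraphicalBilinear in
theorem theorem4p1_general
    {V : Type*} [Fintype V] [DecidableEq V] (G : SimpleGraph V) [DecidableRel G.Adj]
    {Ω : Type*} {mΩ : MeasurableSpace Ω} (μ : Measure Ω) [IsProbabilityMeasure μ]
    (ℱ : Filtration ℕ mΩ)
    {d : ℕ} (hd : 2 ≤ d)
    (X : Set (Fin d → ℝ)) (M : Matrix (Fin d) (Fin d) ℝ)
    (σ lam L S δ : ℝ) (hσ : 0 ≤ σ) (hlam : 0 < lam) (hδ : 0 < δ) (hδ1 : δ ≤ 1)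
    (hL : ∀ x ∈ X, ∀ x' ∈ X, ‖WithLp.toLp 2 (edgeArm x x')‖ ≤ L)
    (hS : ‖WithLp.toLp 2 (vec M)‖ ≤ S)
    (hpos : ∀ x ∈ X, ∀ x' ∈ X, 0 ≤ edgeReward M x x')
    (η : ℕ → V × V → Ω → ℝ) (hη : IsSubGaussianNoise G μ ℱ σ η)
    (V₁ V₂ : Finset V) (hcut : IsCompl V₁ V₂)
    (xopt : V → Fin d → ℝ) (hxopt : ∀ i, xopt i ∈ X)
    (hopt : ∀ x : V → Fin d → ℝ, (∀ i, x i ∈ X) → globalReward G M x ≤ globalReward G M xopt)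
    (hopt_pos : 0 < globalReward G M xopt)
    (xs xs' : Fin d → ℝ) (hxs : xs ∈ X) (hxs' : xs' ∈ X)
    (hs : ∀ x ∈ X, ∀ x' ∈ X,
      (edgeArm x x' + edgeArm x' x) ⬝ᵥ vec M ≤ (edgeArm xs xs' + edgeArm xs' xs) ⬝ᵥ vec M)
    (xt xt' : Fin d → ℝ) (hxt : xt ∈ X) (hxt' : xt' ∈ X)
    (ht : ∀ x ∈ X, ∀ x' ∈ X,
      cutArm G V₁ V₂ x x' ⬝ᵥ vec M ≤ cutArm G V₁ V₂ xt xt' ⬝ᵥ vec M)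
    (γ Δ ε α : ℝ)
    (hγ : IsLeast ((fun x => edgeArm x x ⬝ᵥ vec M /
      (1 / ((edges G).card : ℝ) * globalReward G M xopt)) '' X) γ)
    (hΔ : Δ = (cutArm G V₁ V₂ xt xt' - cutArm G V₁ V₂ xs xs') ⬝ᵥ vec M)
    (hε : ε = Δ / globalReward G M xopt)
    (hα : α = 1 - (uncutFraction G V₁ V₂ * (1 - γ) - ε))
    (T : ℕ) (x x' : ℕ → Ω → Fin d → ℝ)
    (hrun : IsOptimisticRun G ℱ X M η V₁ V₂ σ lam L S δ T x x') :
    (0 ≤ γ ∧ γ ≤ 1 ∧ 0 ≤ Δ ∧ 0 ≤ ε ∧ α ≤ 1) ∧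
    (∀ l : List V, l.Nodup → approxMaxCut G l = (V₁, V₂) →
      (edges G).card ≤ 2 * (edgesFromTo G V₁ V₂ + edgesFromTo G V₂ V₁)) ∧
    ((edges G).card ≤ 2 * (edgesFromTo G V₁ V₂ + edgesFromTo G V₂ V₁) → ε ≤ 1 / 2 ∧ 1 / 2 ≤ α) ∧
    (G.IsBipartiteWith (V₁ : Set V) (V₂ : Set V) → ε = 0 ∧ α = 1) ∧
    1 - δ ≤ μ.real {ω | alphaRegret G M α xopt (fun t => allocate V₁ (x t ω) (x' t ω)) T
      ≤ regretBound d (edges G).card T σ lam L S δ} := by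
  simp only [add_dotProduct, edgeArm_dotProduct_vec] at hs hγ
  rw [sub_dotProduct] at hΔ
  set opt := globalReward G M xopt
  set q := uncutFraction G V₁ V₂
  have hm : 0 < (edges G).card := Finset.card_pos.2 (Finset.nonempty_of_sum_ne_zero hopt_pos.ne')
  obtain ⟨hγ0, hγ1⟩ := mem_Icc_of_isLeast_image_div hm hopt_pos (fun y hy => hpos y hy y hy)
    (fun y hy => (globalReward_const M y).symm.trans_le (hopt _ fun _ => hy)) hγ
  have hcut_s : (1 - q * (1 - γ)) * opt ≤ cutArm G V₁ V₂ xs xs' ⬝ᵥ vec M :=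
    mul_le_cutArm_dotProduct_vec hcut hm (two_mul_globalReward_le hs hxopt)
      (mul_le_of_isLeast_image_div hm hopt_pos hγ hxs)
      (mul_le_of_isLeast_image_div hm hopt_pos hγ hxs')
  have hcut_t : cutArm G V₁ V₂ xt xt' ⬝ᵥ vec M ≤ opt :=
    (globalReward_allocate hcut M xt xt').symm.trans_le (hopt _ (allocate_mem hxt hxt'))
  obtain ⟨hε0, hεq⟩ : ε ∈ Set.Icc 0 (1 - (1 - q * (1 - γ))) :=
    hε ▸ hΔ ▸ sub_div_mem_Icc hopt_pos hcut_s (ht _ hxs _ hxs') hcut_t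
  have hα_opt : α * opt ≤ cutArm G V₁ V₂ xt xt' ⬝ᵥ vec M := by
    have hΔε : ε * opt = Δ := hε ▸ div_mul_cancel₀ Δ hopt_pos.ne'
    rw [hα]
    linarith
  have hα1 : α ≤ 1 := by linarith
  refine ⟨⟨hγ0, hγ1, hΔ ▸ sub_nonneg.2 (ht _ hxs _ hxs'), hε0, hα1⟩,
    fun l hl h => card_edges_le_of_approxMaxCut_eq hcut hl h, fun hhalf => ?_, fun hbip => ?_,
    hrun.one_sub_le_measureReal hη hcut hd hσ hlam hδ hδ1 hL hS hpos hxt hxt' hα_opt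
      ((mul_le_of_le_one_left hopt_pos.le hα1).trans (globalReward_le hL hS hxopt))⟩
  · have hq : q * (1 - γ) ≤ 1 / 2 := (mul_le_of_le_one_right uncutFraction_nonneg
      (sub_le_self 1 hγ0)).trans (uncutFraction_le_half hcut hhalf)
    constructor <;> linarith
  · have hq : q = 0 := uncutFraction_eq_zero hbip
    rw [hq] at hεq hα
    constructor <;> linarith

open GraphicalBilinear in
theorem theorem4p1
    {V : Type*} [Fintype V] [DecidableEq V] (G : SimpleGraph V) [DecidableRel G.Adj]
    {Ω : Type*} {mΩ : MeasurableSpace Ω} (μ : Measure Ω) [IsProbabilityMeasure μ]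
    (ℱ : Filtration ℕ mΩ)
    {d : ℕ} (hd : 2 ≤ d)
    (X : Finset (Fin d → ℝ)) (M : Matrix (Fin d) (Fin d) ℝ)
    (σ lam L S δ : ℝ) (hσ : 0 ≤ σ) (hlam : 0 < lam) (hδ : 0 < δ) (hδ1 : δ ≤ 1)
    -- the Euclidean norms of the edge-arms are at most `L`, the Frobenius norm of `M` at most `S`
    (hL : ∀ x ∈ X, ∀ x' ∈ X, ‖WithLp.toLp 2 (edgeArm x x')‖ ≤ L)
    (hS : ‖WithLp.toLp 2 (vec M)‖ ≤ S)
    (hpos : ∀ x ∈ X, ∀ x' ∈ X, 0 ≤ edgeReward M x x')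
    (η : ℕ → V × V → Ω → ℝ) (hη : IsSubGaussianNoise G μ ℱ σ η)
    -- the cut
    (V₁ V₂ : Finset V) (hdisj : Disjoint V₁ V₂) (hunion : V₁ ∪ V₂ = Finset.univ)
    -- the optimal joint arm
    (xopt : V → Fin d → ℝ) (hxopt : ∀ i, xopt i ∈ X)
    (hopt : ∀ x : V → Fin d → ℝ, (∀ i, x i ∈ X) → globalReward G M x ≤ globalReward G M xopt)
    (hopt_pos : 0 < globalReward G M xopt)
    -- the pair that is best along one edge
    (xs xs' : Fin d → ℝ) (hxs : xs ∈ X) (hxs' : xs' ∈ X)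
    (hs : ∀ x ∈ X, ∀ x' ∈ X,
      (edgeArm x x' + edgeArm x' x) ⬝ᵥ vec M ≤ (edgeArm xs xs' + edgeArm xs' xs) ⬝ᵥ vec M)
    -- the pair that is best for the cut
    (xt xt' : Fin d → ℝ) (hxt : xt ∈ X) (hxt' : xt' ∈ X)
    (ht : ∀ x ∈ X, ∀ x' ∈ X,
      cutArm G V₁ V₂ x x' ⬝ᵥ vec M ≤ cutArm G V₁ V₂ xt xt' ⬝ᵥ vec M)
    (γ Δ ε α : ℝ)
    (hγ : IsLeast ((fun x => edgeArm x x ⬝ᵥ vec M /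
      (1 / ((edges G).card : ℝ) * globalReward G M xopt)) '' (X : Set (Fin d → ℝ))) γ)
    (hΔ : Δ = (cutArm G V₁ V₂ xt xt' - cutArm G V₁ V₂ xs xs') ⬝ᵥ vec M)
    (hε : ε = Δ / globalReward G M xopt)
    (hα : α = 1 - (((edgesFromTo G V₁ V₁ : ℝ) + edgesFromTo G V₂ V₂) / ((edges G).card : ℝ)
      * (1 - γ) - ε))
    -- a run of the algorithm
    (T : ℕ) (x x' : ℕ → Ω → Fin d → ℝ)
    (hrun : IsImprovedOFULRun G ℱ X M η V₁ V₂ σ lam L S δ T x x') :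
    -- the ranges of the parameters
    (0 ≤ γ ∧ γ ≤ 1 ∧ 0 ≤ Δ ∧ 0 ≤ ε ∧ α ≤ 1) ∧
    -- the greedy algorithm cuts at least half of the edges
    (∀ l : List V, l.Nodup → (∀ i, i ∈ l) → approxMaxCut G l = (V₁, V₂) →
      (edges G).card ≤ 2 * (edgesFromTo G V₁ V₂ + edgesFromTo G V₂ V₁)) ∧
    -- the ranges of `ε` and `α` for a cut through at least half of the edges
    ((edges G).card ≤ 2 * (edgesFromTo G V₁ V₂ + edgesFromTo G V₂ V₁) → ε ≤ 1 / 2 ∧ 1 / 2 ≤ α) ∧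
    -- bipartite graphs
    (G.IsBipartiteWith (V₁ : Set V) (V₂ : Set V) → ε = 0 ∧ α = 1) ∧
    -- the `α`-regret
    1 - δ ≤ μ.real {ω | alphaRegret G M α xopt (fun t => allocate V₁ (x t ω) (x' t ω)) T
      ≤ regretBound d (edges G).card T σ lam L S δ} := by
  obtain ⟨hparam, hgreedy, hhalf, hbip, hregret⟩ := theorem4p1_general G μ ℱ hd X M σ lam L S δ hσ
    hlam hδ hδ1 hL hS hpos η hη V₁ V₂ ⟨hdisj, codisjoint_iff.2 hunion⟩ xopt hxopt hopt hopt_pos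
    xs xs' hxs hxs' hs xt xt' hxt hxt' ht γ Δ ε α hγ hΔ hε hα T x x' hrun.isOptimisticRun
  exact ⟨hparam, fun l hl _ => hgreedy l hl, hhalf, hbip, hregret⟩
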